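/- Let $d\ge 1$, let $V\subset\mathbb{R}^d$ be non-empty, open and bounded, and let $f:\partial V\to\mathbb{R}$ be continuous. Let $\vartheta_1,\vartheta_2,\dots$ be independent random variables on a probability space $(\Omega,\mathcal F,P)$, each uniformly distributed on the unit sphere of $\mathbb{R}^d$, and let $0<r<1$. For $v\in V$ define $$X_r^v(1)=v,\qquad X_r^v(n+1)=X_r^v(n)+r\,d\bigl(X_r^v(n),\partial V\bigr)\,\vartheta_n\quad(n\ge 1),$$ where $d(x,\partial V)$ is the Euclidean distance from $x$ to $\partial V$. Then for every $v\in V$ the limit $X_r^v(\infty)=\lim_{n\to\infty}X_r^v(n)$ exists and lies in $\partial V$ almost surely, $f(X_r^v(\infty))$ is integrable, and the function $h:\overline V\to\mathbb{R}$ given by $$h(v)=\begin{cases} f(v), & v\in\partial V,\\ E\bigl[f(X_r^v(\infty))\bigr], & v\in V,\end{cases}$$ is harmonic in $V$, that is, $h$ is twice continuously differentiable in $V$ and $\Delta h=0$ there. -/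

import Mathlib

open MeasureTheory ProbabilityTheory Filter Topology

noncomputable section

/-- The uniform distribution on the unit sphere of `ℝ^d`, as a measure on `ℝ^d`: the normalised
surface measure. (For `d = 1` it gives mass `1/2` to each of the points `1` and `-1`.) -/
def uniformSphere (d : ℕ) : Measure (EuclideanSpace ℝ (Fin d)) :=
  (((volume : Measure (EuclideanSpace ℝ (Fin d))).toSphere Set.univ)⁻¹ •
    (volume : Measure (EuclideanSpace ℝ (Fin d))).toSphere).map Subtype.val

/-- The random sequence started at `v` which moves from its current position `x` to
`x + r d(x, ∂V) ϑ`. The index starts at `0`. -/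
def sphereWalk {d : ℕ} {Ω : Type*} (V : Set (EuclideanSpace ℝ (Fin d)))
    (ϑ : ℕ → Ω → EuclideanSpace ℝ (Fin d)) (r : ℝ) (v : EuclideanSpace ℝ (Fin d)) :
    ℕ → Ω → EuclideanSpace ℝ (Fin d)
  | 0, _ => v
  | n + 1, ω => sphereWalk V ϑ r v n ω +
      (r * Metric.infDist (sphereWalk V ϑ r v n ω) (frontier V)) • ϑ n ω

/-- The pointwise limit of the random sequence (an arbitrary point where there is no limit). -/
def sphereWalkLimit {d : ℕ} {Ω : Type*} (V : Set (EuclideanSpace ℝ (Fin d)))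
    (ϑ : ℕ → Ω → EuclideanSpace ℝ (Fin d)) (r : ℝ) (v : EuclideanSpace ℝ (Fin d)) (ω : Ω) :
    EuclideanSpace ℝ (Fin d) :=
  limUnder atTop (fun n => sphereWalk V ϑ r v n ω)

open Classical in
/-- The function equal to `f` on `∂V` and to the expectation of `f` at the limit of the random
sequence started at `v`, for `v ∈ V`. Only its values on the closure of `V` are meaningful. -/
def dirichletFun {d : ℕ} {Ω : Type*} [MeasurableSpace Ω] (P : Measure Ω)
    (V : Set (EuclideanSpace ℝ (Fin d))) (f : EuclideanSpace ℝ (Fin d) → ℝ)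
    (ϑ : ℕ → Ω → EuclideanSpace ℝ (Fin d)) (r : ℝ) (v : EuclideanSpace ℝ (Fin d)) : ℝ :=
  if v ∈ frontier V then f v else ∫ ω, f (sphereWalkLimit V ϑ r v ω) ∂P

end

/-!
Write `σ` for the uniform distribution on the unit sphere and `sphereMean g x ρ` for
`∫ g (x + ρ θ) dσ(θ)`. The coordinates of the walk are bounded martingales, so the walk converges
almost surely; its step lengths are `r` times the distance to the boundary and tend to zero, so the
limit lies on the boundary (`ae_tendsto_sphereWalk`).

For harmonicity, suppose first that the boundary function is the restriction of a continuous `u`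
which is subharmonic in `V`. Sweep `u` out in the manner of Poincaré: replace it successively, in
countably many balls each recurring infinitely often, by the solution of the Dirichlet problem in
the ball. The functions obtained increase, are continuous and subharmonic, and are equal to `u` on
the boundary; their supremum `H` has the mean value property (`exists_balayage`). Composed with the
walk, a subharmonic `w ≥ u` with boundary values `u` is a submartingale, so
`w v ≤ E[u (limit of the walk from v)]`, and hence `H v` is at most this expectation. Conversely
`H v = E[H (X n)] ≥ E[u (X n)]`, which tends to the same expectation. So the expectation is `H v`
(`IsSubharmonicAbove.hasHarmonicExpectation`). No regularity of the boundary enters.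

Exponentials `x ↦ exp ⟪a, x⟫` are convex, hence subharmonic, and their linear combinations are
uniformly dense in the continuous functions on the boundary by the Stone–Weierstrass theorem. The
mean value property survives linear combinations and uniform limits, so it holds for every
continuous `f`. A bounded measurable function with the mean value property is smooth, since up to a
constant factor it agrees with its convolution with a radial bump function, and its Laplacian
vanishes by Taylor expansion (`harmonicOnNhd_of_sphereMean_eq`).

The Dirichlet problem in a ball is solved without the Poisson kernel. Harmonic polynomials have the
mean value property (`sphereMean_polyFun`, by integration by parts against radial weights and polar
coordinates); with the maximum principle, a dimension count shows that polynomial boundary data have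
polynomial harmonic extensions (`exists_harmonic_polynomial_eq_on_sphere`), and continuous data are
uniform limits of polynomials (`exists_harmonic_lift`).
-/

section

variable {d : ℕ}

local notation "𝔼" => EuclideanSpace ℝ (Fin d)

/-! ### The uniform distribution on the sphere -/

instance nontrivial_euclideanSpace_of_neZero [NeZero d] : Nontrivial 𝔼 := by
  apply Module.nontrivial_of_finrank_pos (R := ℝ)
  simpa using Nat.pos_of_ne_zero (NeZero.ne d)

theorem toSphere_univ_ne_zero [NeZero d] :
    (volume : Measure 𝔼).toSphere Set.univ ≠ 0 := by
  rw [Ne, Measure.measure_univ_eq_zero]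
  exact Measure.toSphere_ne_zero _

instance isProbabilityMeasure_uniformSphere [NeZero d] :
    IsProbabilityMeasure (uniformSphere d) := by
  constructor
  rw [uniformSphere, Measure.map_apply measurable_subtype_coe MeasurableSet.univ]
  simp only [Set.preimage_univ, Measure.smul_apply, smul_eq_mul]
  exact ENNReal.inv_mul_cancel toSphere_univ_ne_zero (measure_ne_top _ _)

theorem integral_uniformSphere (g : 𝔼 → ℝ) :
    ∫ θ, g θ ∂uniformSphere d = ((volume : Measure 𝔼).toSphere.real Set.univ)⁻¹ *
      ∫ θ : Metric.sphere (0 : 𝔼) 1, g θ ∂(volume : Measure 𝔼).toSphere := by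
  rw [uniformSphere, (MeasurableEmbedding.subtype_coe
    Metric.isClosed_sphere.measurableSet).integral_map, integral_smul_measure]
  simp [measureReal_def, smul_eq_mul]

theorem ae_norm_eq_one_uniformSphere : ∀ᵐ θ ∂uniformSphere d, ‖θ‖ = 1 := by
  rw [uniformSphere, (MeasurableEmbedding.subtype_coe
    Metric.isClosed_sphere.measurableSet).ae_map_iff]
  exact Eventually.of_forall fun θ => by simp

/-- The surface area of the unit sphere. -/
noncomputable def sphereArea (d : ℕ) : ℝ :=
  (volume : Measure (EuclideanSpace ℝ (Fin d))).toSphere.real Set.univ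

theorem sphereArea_pos [NeZero d] : 0 < sphereArea d :=
  ENNReal.toReal_pos toSphere_univ_ne_zero (measure_ne_top _ _)

/-- Integration in polar coordinates. -/
theorem integral_eq_integral_polar [NeZero d] {g : 𝔼 → ℝ} (hg : Integrable g) :
    ∫ y, g y = sphereArea d *
      ∫ ρ in Set.Ioi (0 : ℝ), ρ ^ (d - 1) * ∫ θ, g (ρ • θ) ∂uniformSphere d := by
  have hmp := (volume : Measure 𝔼).measurePreserving_homeomorphUnitSphereProd
  have hemb := (homeomorphUnitSphereProd 𝔼).measurableEmbedding
  set G : Metric.sphere (0 : 𝔼) 1 × Set.Ioi (0 : ℝ) → ℝ := fun z => g (z.2.1 • z.1.1) with hG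
  have hGc : ∀ x : ({0}ᶜ : Set 𝔼), G (homeomorphUnitSphereProd 𝔼 x) = g x := by
    intro x
    have hx : ‖(x : 𝔼)‖ ≠ 0 := norm_ne_zero_iff.2 x.2
    simp [hG, homeomorphUnitSphereProd, smul_smul, mul_inv_cancel₀ hx]
  have hint : Integrable G ((volume : Measure 𝔼).toSphere.prod
      (.volumeIoiPow (Module.finrank ℝ 𝔼 - 1))) := by
    rw [← hmp.integrable_comp_emb hemb]
    have : G ∘ homeomorphUnitSphereProd 𝔼 = g ∘ Subtype.val := funext hGc
    rw [this, ← integrableOn_iff_comap_subtypeVal (measurableSet_singleton _).compl]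
    exact hg.integrableOn
  calc ∫ y, g y = ∫ x : ({0}ᶜ : Set 𝔼), g x ∂(Measure.comap Subtype.val volume) := by
        rw [integral_subtype_comap (measurableSet_singleton _).compl, restrict_compl_singleton]
    _ = ∫ z, G z ∂((volume : Measure 𝔼).toSphere.prod
          (.volumeIoiPow (Module.finrank ℝ 𝔼 - 1))) := by
        rw [← hmp.integral_comp hemb]
        simp_rw [hGc]
    _ = ∫ ρ : Set.Ioi (0 : ℝ), sphereArea d * ∫ θ, g (ρ.1 • θ) ∂uniformSphere d
          ∂(.volumeIoiPow (Module.finrank ℝ 𝔼 - 1)) := by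
        rw [integral_prod_symm _ hint]
        congr 1
        ext ρ
        rw [integral_uniformSphere]
        exact (mul_inv_cancel_left₀ sphereArea_pos.ne' _).symm
    _ = _ := by
        rw [integral_const_mul]
        congr 1
        simp only [Measure.volumeIoiPow, ENNReal.ofReal, finrank_euclideanSpace, Fintype.card_fin]
        rw [integral_withDensity_eq_integral_smul
            ((measurable_subtype_coe.pow_const _).real_toNNReal),
          integral_subtype_comap measurableSet_Ioi
            fun a : ℝ ↦ Real.toNNReal (a ^ (d - 1)) • ∫ θ, g (a • θ) ∂uniformSphere d]
        refine setIntegral_congr_fun measurableSet_Ioi fun x hx ↦ ?_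
        simp only [NNReal.smul_def, Real.coe_toNNReal _ (pow_nonneg (le_of_lt hx) _), smul_eq_mul]

/-- The mean of `g` over the sphere with centre `x` and radius `ρ`. -/
noncomputable def sphereMean (g : 𝔼 → ℝ) (x : 𝔼) (ρ : ℝ) : ℝ := ∫ θ, g (x + ρ • θ) ∂uniformSphere d

theorem ae_mem_sphere_uniformSphere (x : 𝔼) {ρ : ℝ} (hρ : 0 ≤ ρ) :
    ∀ᵐ θ ∂uniformSphere d, x + ρ • θ ∈ Metric.sphere x ρ := by
  filter_upwards [ae_norm_eq_one_uniformSphere] with θ hθ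
  simp [norm_smul, hθ, abs_of_nonneg hρ]

theorem integrable_comp_sphere [NeZero d] {g : 𝔼 → ℝ} (hg : Measurable g) {x : 𝔼} {ρ C : ℝ}
    (hρ : 0 ≤ ρ) (hC : ∀ y ∈ Metric.sphere x ρ, |g y| ≤ C) :
    Integrable (fun θ => g (x + ρ • θ)) (uniformSphere d) := by
  refine Integrable.of_bound (C := C) ?_ ?_
  · exact (hg.comp (by fun_prop)).aestronglyMeasurable
  · filter_upwards [ae_mem_sphere_uniformSphere x hρ] with θ hθ
    exact hC _ hθ

theorem Continuous.integrable_comp_sphere [NeZero d] {g : 𝔼 → ℝ} (hg : Continuous g) (x : 𝔼)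
    {ρ : ℝ} (hρ : 0 ≤ ρ) : Integrable (fun θ => g (x + ρ • θ)) (uniformSphere d) := by
  obtain ⟨C, hC⟩ := (isCompact_sphere x ρ).exists_bound_of_continuousOn hg.continuousOn
  exact _root_.integrable_comp_sphere hg.measurable hρ hC

theorem sphereMean_congr {g g' : 𝔼 → ℝ} {x : 𝔼} {ρ : ℝ} (hρ : 0 ≤ ρ)
    (h : ∀ y ∈ Metric.sphere x ρ, g y = g' y) : sphereMean g x ρ = sphereMean g' x ρ := by
  refine integral_congr_ae ?_
  filter_upwards [ae_mem_sphere_uniformSphere x hρ] with θ hθ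
  exact h _ hθ

theorem sphereMean_const [NeZero d] (c : ℝ) (x : 𝔼) (ρ : ℝ) :
    sphereMean (fun _ => c) x ρ = c := by
  simp [sphereMean]

theorem sphereMean_mono [NeZero d] {g g' : 𝔼 → ℝ} {x : 𝔼} {ρ : ℝ} (hρ : 0 ≤ ρ)
    (hg : Integrable (fun θ => g (x + ρ • θ)) (uniformSphere d))
    (hg' : Integrable (fun θ => g' (x + ρ • θ)) (uniformSphere d))
    (h : ∀ y ∈ Metric.sphere x ρ, g y ≤ g' y) : sphereMean g x ρ ≤ sphereMean g' x ρ := by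
  refine integral_mono_ae hg hg' ?_
  filter_upwards [ae_mem_sphere_uniformSphere x hρ] with θ hθ
  exact h _ hθ

/-! ### The mean value property of harmonic polynomials -/

theorem continuous_integral_uniformSphere [NeZero d] {X : Type*} [TopologicalSpace X]
    [FirstCountableTopology X] [LocallyCompactSpace X] {F : X → 𝔼 → ℝ}
    (hF : Continuous (Function.uncurry F)) :
    Continuous fun x => ∫ θ, F x θ ∂uniformSphere d := by
  have h : (uniformSphere d).restrict (Metric.sphere 0 1) = uniformSphere d := by
    apply Measure.restrict_eq_self_of_ae_mem
    filter_upwards [ae_norm_eq_one_uniformSphere] with θ hθ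
    simpa using hθ
  rw [← h]
  exact continuous_parametric_integral_of_continuous hF (isCompact_sphere _ _)

/-- A polynomial, as a function on Euclidean space. -/
noncomputable def polyFun (p : MvPolynomial (Fin d) ℝ) (x : 𝔼) : ℝ :=
  MvPolynomial.eval (fun i => x i) p

theorem hasFDerivAt_polyFun (p : MvPolynomial (Fin d) ℝ) (x : 𝔼) :
    HasFDerivAt (polyFun p) (∑ i, polyFun (MvPolynomial.pderiv i p) x •
      (EuclideanSpace.proj i : 𝔼 →L[ℝ] ℝ)) x := by
  induction p using MvPolynomial.induction_on with
  | C a =>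
    have hfun : polyFun (MvPolynomial.C a) = fun _ : 𝔼 => a := by
      ext y; simp [polyFun]
    rw [hfun]
    refine (hasFDerivAt_const a x).congr_fderiv ?_
    simp [polyFun]
  | add p q hp hq =>
    have hfun : polyFun (p + q) = (polyFun p + polyFun q : 𝔼 → ℝ) := by
      ext y; simp [polyFun]
    rw [hfun]
    refine (hp.add hq).congr_fderiv ?_
    simp [polyFun, add_smul, Finset.sum_add_distrib]
  | mul_X p j hp =>
    have hj : HasFDerivAt (fun y : 𝔼 => y j) (EuclideanSpace.proj j : 𝔼 →L[ℝ] ℝ) x :=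
      (EuclideanSpace.proj j : 𝔼 →L[ℝ] ℝ).hasFDerivAt
    have := hp.mul hj
    have hfun : polyFun (p * MvPolynomial.X j) = polyFun p * fun y : 𝔼 => y j := by
      ext y; simp [polyFun]
    rw [hfun]
    refine this.congr_fderiv ?_
    ext y
    simp [polyFun, MvPolynomial.pderiv_X, Pi.single_apply, add_mul,
      Finset.sum_add_distrib, apply_ite, Finset.mul_sum]
    refine Finset.sum_congr rfl fun i _ => by ring

theorem continuous_polyFun (p : MvPolynomial (Fin d) ℝ) : Continuous (polyFun p) :=
  continuous_iff_continuousAt.2 fun x => (hasFDerivAt_polyFun p x).continuousAt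

/-- The Laplacian on polynomials. -/
noncomputable def polyLaplacian (d : ℕ) :
    MvPolynomial (Fin d) ℝ →ₗ[ℝ] MvPolynomial (Fin d) ℝ :=
  ∑ i, (MvPolynomial.pderiv i).toLinearMap ∘ₗ (MvPolynomial.pderiv i).toLinearMap

theorem polyLaplacian_apply (p : MvPolynomial (Fin d) ℝ) :
    polyLaplacian d p = ∑ i, MvPolynomial.pderiv i (MvPolynomial.pderiv i p) := by
  simp [polyLaplacian, LinearMap.sum_apply]

theorem hasDerivAt_max_zero_sq (s : ℝ) :
    HasDerivAt (fun s : ℝ => (max 0 s) ^ 2) (2 * max 0 s) s := by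
  rcases lt_trichotomy s 0 with hs | rfl | hs
  · rw [max_eq_left hs.le, mul_zero]
    refine (hasDerivAt_const s (0 : ℝ)).congr_of_eventuallyEq ?_
    filter_upwards [Iio_mem_nhds hs] with t ht
    simp [max_eq_left (le_of_lt (Set.mem_Iio.1 ht))]
  · rw [hasDerivAt_iff_isLittleO]
    simp only [max_self, mul_zero, smul_zero, sub_zero, ne_eq, OfNat.ofNat_ne_zero,
      not_false_eq_true, zero_pow]
    refine Asymptotics.IsBigO.trans_isLittleO (g := fun t : ℝ => t ^ 2) ?_ ?_
    · refine Asymptotics.IsBigO.of_bound 1 (Eventually.of_forall fun t => ?_)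
      rw [norm_pow, norm_pow, one_mul]
      gcongr
      rw [Real.norm_eq_abs, Real.norm_eq_abs, abs_of_nonneg (le_max_left _ _)]
      exact max_le (abs_nonneg _) (le_abs_self _)
    · exact Asymptotics.isLittleO_pow_id one_lt_two
  · rw [max_eq_right hs.le]
    have := (hasDerivAt_id s).pow 2
    refine (this.congr_deriv (by simp)).congr_of_eventuallyEq ?_
    filter_upwards [Ioi_mem_nhds hs] with t ht
    simp [max_eq_right (le_of_lt (Set.mem_Ioi.1 ht))]

theorem hasFDerivAt_max_sub_norm_sq (R : ℝ) (y : 𝔼) :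
    HasFDerivAt (fun y : 𝔼 => (max 0 (R ^ 2 - ‖y‖ ^ 2)) ^ 2)
      ((-4 * max 0 (R ^ 2 - ‖y‖ ^ 2)) • innerSL ℝ y) y := by
  have h1 : HasFDerivAt (fun y : 𝔼 => R ^ 2 - ‖y‖ ^ 2) (-(2 • innerSL ℝ y)) y :=
    (hasStrictFDerivAt_norm_sq y).hasFDerivAt.const_sub _
  refine ((hasDerivAt_max_zero_sq _).comp_hasFDerivAt y h1).congr_fderiv ?_
  ext z
  simp
  ring

theorem hasCompactSupport_max_sub_norm_sq (R : ℝ) :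
    HasCompactSupport fun y : 𝔼 => max 0 (R ^ 2 - ‖y‖ ^ 2) := by
  refine HasCompactSupport.intro (isCompact_closedBall (0 : 𝔼) |R|) fun y hy => ?_
  have h : |R| < ‖y‖ := by simpa using hy
  have := pow_lt_pow_left₀ h (abs_nonneg R) two_ne_zero
  rw [sq_abs] at this
  exact max_eq_left (by linarith)

/-- Integration by parts of the Laplacian of a harmonic polynomial against the radial weight
`(R² - |y|²)₊²`, whose gradient is `-4 (R² - |y|²)₊ y`. -/
theorem integral_radial_deriv_mul_eq_zero {p : MvPolynomial (Fin d) ℝ} (hp : polyLaplacian d p = 0)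
    (x : 𝔼) (R : ℝ) :
    ∫ y : 𝔼, (∑ i, polyFun (MvPolynomial.pderiv i p) (x + y) * y i) *
      max 0 (R ^ 2 - ‖y‖ ^ 2) = 0 := by
  have hc : Continuous fun y : 𝔼 => max 0 (R ^ 2 - ‖y‖ ^ 2) := by fun_prop
  have hs := hasCompactSupport_max_sub_norm_sq (d := d) R
  have hpc : ∀ q : MvPolynomial (Fin d) ℝ, Continuous fun y : 𝔼 => polyFun q (x + y) :=
    fun q => (continuous_polyFun q).comp (by fun_prop)
  have hint : ∀ g : 𝔼 → ℝ, Continuous g →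
      Integrable fun y : 𝔼 => g y * max 0 (R ^ 2 - ‖y‖ ^ 2) := fun g hg =>
    (hg.mul hc).integrable_of_hasCompactSupport hs.mul_left
  have hderiv : ∀ (q : MvPolynomial (Fin d) ℝ) (y : 𝔼), HasFDerivAt (fun y => polyFun q (x + y))
      (∑ i, polyFun (MvPolynomial.pderiv i q) (x + y) •
      (EuclideanSpace.proj i : 𝔼 →L[ℝ] ℝ)) y := fun q y =>
    (hasFDerivAt_comp_add_left x).2 (hasFDerivAt_polyFun q (x + y))
  have key : ∀ i, ∫ y : 𝔼, polyFun (MvPolynomial.pderiv i p) (x + y) *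
        (-4 * (max 0 (R ^ 2 - ‖y‖ ^ 2) * y i)) =
      - ∫ y : 𝔼, polyFun (MvPolynomial.pderiv i (MvPolynomial.pderiv i p)) (x + y) *
        (max 0 (R ^ 2 - ‖y‖ ^ 2)) ^ 2 := by
    intro i
    have h1 : ∀ y : 𝔼, fderiv ℝ (fun y => polyFun (MvPolynomial.pderiv i p) (x + y)) y
        (EuclideanSpace.single i 1) =
        polyFun (MvPolynomial.pderiv i (MvPolynomial.pderiv i p)) (x + y) := by
      intro y
      rw [(hderiv _ y).fderiv]
      simp
    have h2 : ∀ y : 𝔼, fderiv ℝ (fun y : 𝔼 => (max 0 (R ^ 2 - ‖y‖ ^ 2)) ^ 2) y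
        (EuclideanSpace.single i 1) = -4 * (max 0 (R ^ 2 - ‖y‖ ^ 2) * y i) := by
      intro y
      rw [(hasFDerivAt_max_sub_norm_sq R y).fderiv]
      simp [EuclideanSpace.inner_single_right, mul_assoc]
    have := integral_mul_fderiv_eq_neg_fderiv_mul_of_integrable (μ := (volume : Measure 𝔼))
      (f := fun y => polyFun (MvPolynomial.pderiv i p) (x + y))
      (g := fun y : 𝔼 => (max 0 (R ^ 2 - ‖y‖ ^ 2)) ^ 2) (v := EuclideanSpace.single i 1)
      ?_ ?_ ?_ (fun y _ => (hderiv _ y).differentiableAt)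
      (fun y _ => (hasFDerivAt_max_sub_norm_sq R y).differentiableAt)
    · simpa only [h1, h2] using this
    · simp only [h1]
      refine (hint (fun y => polyFun (MvPolynomial.pderiv i (MvPolynomial.pderiv i p)) (x + y) *
        max 0 (R ^ 2 - ‖y‖ ^ 2)) ((hpc _).mul hc)).congr (Eventually.of_forall fun y => ?_)
      simp only; ring
    · simp only [h2]
      refine (hint (fun y => polyFun (MvPolynomial.pderiv i p) (x + y) * (-4 * y i))
        ((hpc _).mul (by fun_prop))).congr (Eventually.of_forall fun y => ?_)
      simp only; ring
    · refine (hint (fun y => polyFun (MvPolynomial.pderiv i p) (x + y) *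
        max 0 (R ^ 2 - ‖y‖ ^ 2)) ((hpc _).mul hc)).congr (Eventually.of_forall fun y => ?_)
      simp only; ring
  have hsum : ∑ i, ∫ y : 𝔼, polyFun (MvPolynomial.pderiv i p) (x + y) *
        (-4 * (max 0 (R ^ 2 - ‖y‖ ^ 2) * y i)) = 0 := by
    simp_rw [key]
    rw [Finset.sum_neg_distrib, neg_eq_zero, ← integral_finsetSum]
    · rw [← integral_zero 𝔼 ℝ (μ := volume)]
      congr 1
      ext y
      rw [← Finset.sum_mul]
      have : ∑ i, polyFun (MvPolynomial.pderiv i (MvPolynomial.pderiv i p)) (x + y) =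
          polyFun (polyLaplacian d p) (x + y) := by
        rw [polyLaplacian_apply]
        simp [polyFun]
      rw [this, hp]
      simp [polyFun]
    · intro i _
      refine (hint (fun y => polyFun (MvPolynomial.pderiv i (MvPolynomial.pderiv i p)) (x + y) *
        max 0 (R ^ 2 - ‖y‖ ^ 2)) ((hpc _).mul hc)).congr (Eventually.of_forall fun y => ?_)
      simp only; ring
  rw [← integral_finsetSum] at hsum
  · have h4 : ∀ y : 𝔼, ∑ i, polyFun (MvPolynomial.pderiv i p) (x + y) *
        (-4 * (max 0 (R ^ 2 - ‖y‖ ^ 2) * y i)) =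
        -4 * ((∑ i, polyFun (MvPolynomial.pderiv i p) (x + y) * y i) *
      max 0 (R ^ 2 - ‖y‖ ^ 2)) := by
      intro y
      rw [Finset.sum_mul, Finset.mul_sum]
      exact Finset.sum_congr rfl fun i _ => by ring
    simp_rw [h4] at hsum
    rw [integral_const_mul] at hsum
    simpa using hsum
  · intro i _
    refine (hint (fun y => polyFun (MvPolynomial.pderiv i p) (x + y) * (-4 * y i))
        ((hpc _).mul (by fun_prop))).congr (Eventually.of_forall fun y => ?_)
    simp only; ring

/-- Differentiating `R² ∫₀ᴿ k - ∫₀ᴿ ρ² k = 0` in `R` gives `2 R ∫₀ᴿ k = 0`, and differentiating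
once more gives `k = 0`. -/
theorem eq_zero_of_forall_integral_sq_sub_sq_mul_eq_zero {k : ℝ → ℝ} (hk : Continuous k)
    (h : ∀ R, 0 < R → ∫ ρ in (0 : ℝ)..R, (R ^ 2 - ρ ^ 2) * k ρ = 0) {R : ℝ} (hR : 0 < R) :
    k R = 0 := by
  have hK : ∀ R, HasDerivAt (fun R => ∫ ρ in (0 : ℝ)..R, k ρ) (k R) R := fun R =>
    hk.integral_hasStrictDerivAt 0 R |>.hasDerivAt
  have hL : ∀ R, HasDerivAt (fun R => ∫ ρ in (0 : ℝ)..R, ρ ^ 2 * k ρ) (R ^ 2 * k R) R := fun R =>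
    Continuous.integral_hasStrictDerivAt (by fun_prop) 0 R |>.hasDerivAt
  have hzero : ∀ R, 0 < R →
      R ^ 2 * (∫ ρ in (0 : ℝ)..R, k ρ) - ∫ ρ in (0 : ℝ)..R, ρ ^ 2 * k ρ = 0 := by
    intro R hR
    rw [← intervalIntegral.integral_const_mul, ← intervalIntegral.integral_sub]
    · simpa only [sub_mul] using h R hR
    · exact Continuous.intervalIntegrable (by fun_prop) _ _
    · exact Continuous.intervalIntegrable (by fun_prop) _ _
  have hderiv_zero : ∀ {f : ℝ → ℝ} {f' R : ℝ}, 0 < R → (∀ R, 0 < R → f R = 0) →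
      HasDerivAt f f' R → f' = 0 := by
    intro f f' R hR hf hd
    refine hd.unique ((hasDerivAt_const R (0 : ℝ)).congr_of_eventuallyEq ?_)
    filter_upwards [Ioi_mem_nhds hR] with t ht using hf t ht
  have hKzero : ∀ R, 0 < R → ∫ ρ in (0 : ℝ)..R, k ρ = 0 := by
    intro R hR
    have h1 := hderiv_zero hR hzero ((((hasDerivAt_id R).pow 2).mul (hK R)).sub (hL R))
    simpa [hR.ne'] using h1
  exact hderiv_zero hR hKzero (hK R)

/-- The mean over a sphere of the radial derivative of a harmonic polynomial vanishes: in polar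
coordinates, `integral_radial_deriv_mul_eq_zero` says that the function `ρ ↦ ρ ^ d * mean` is
orthogonal on `(0, R)` to `R² - ρ²`, for every `R`. -/
theorem integral_deriv_sphere_eq_zero [NeZero d] {p : MvPolynomial (Fin d) ℝ}
    (hp : polyLaplacian d p = 0) (x : 𝔼) {t : ℝ} (ht : 0 < t) :
    ∫ θ, ∑ i, polyFun (MvPolynomial.pderiv i p) (x + t • θ) * θ i ∂uniformSphere d = 0 := by
  set n : ℝ → ℝ := fun t =>
    ∫ θ, ∑ i, polyFun (MvPolynomial.pderiv i p) (x + t • θ) * θ i ∂uniformSphere d with hn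
  have hpc : ∀ q : MvPolynomial (Fin d) ℝ, Continuous (polyFun q) := continuous_polyFun
  have hnc : Continuous n := by
    apply continuous_integral_uniformSphere
    simp only [Function.uncurry_def]
    fun_prop
  have hk : Continuous fun ρ : ℝ => ρ ^ (d - 1) * (ρ * n ρ) := by fun_prop
  have h0 := eq_zero_of_forall_integral_sq_sub_sq_mul_eq_zero hk ?_ ht
  · have := pow_pos ht (d - 1)
    simpa [this.ne', ht.ne'] using h0
  intro R hR
  have hI := integral_radial_deriv_mul_eq_zero hp x R
  rw [integral_eq_integral_polar] at hI
  · have hI := (mul_eq_zero.1 hI).resolve_left sphereArea_pos.ne'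
    rw [intervalIntegral.integral_of_le hR.le]
    refine Eq.trans ?_ hI
    have hval : ∀ ρ ∈ Set.Ioi (0 : ℝ), ρ ^ (d - 1) * ∫ θ,
        (∑ i, polyFun (MvPolynomial.pderiv i p) (x + ρ • θ) * (ρ • θ) i) *
          max 0 (R ^ 2 - ‖ρ • θ‖ ^ 2) ∂uniformSphere d =
        max 0 (R ^ 2 - ρ ^ 2) * (ρ ^ (d - 1) * (ρ * n ρ)) := by
      intro ρ hρ
      have : ∫ θ, (∑ i, polyFun (MvPolynomial.pderiv i p) (x + ρ • θ) * (ρ • θ) i) *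
          max 0 (R ^ 2 - ‖ρ • θ‖ ^ 2) ∂uniformSphere d =
          ∫ θ, (max 0 (R ^ 2 - ρ ^ 2) * ρ) *
          ∑ i, polyFun (MvPolynomial.pderiv i p) (x + ρ • θ) * θ i ∂uniformSphere d := by
        refine integral_congr_ae ?_
        filter_upwards [ae_norm_eq_one_uniformSphere] with θ hθ
        rw [norm_smul, hθ, Real.norm_eq_abs, mul_one, sq_abs, Finset.sum_mul, Finset.mul_sum]
        refine Finset.sum_congr rfl fun i _ => ?_
        simp only [PiLp.smul_apply, smul_eq_mul]
        ring
      rw [this, integral_const_mul]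
      ring
    rw [setIntegral_congr_fun measurableSet_Ioi hval]
    rw [setIntegral_eq_of_subset_of_forall_sdiff_eq_zero measurableSet_Ioi
      (s := Set.Ioc 0 R) (t := Set.Ioi (0 : ℝ)) (fun a ha => ha.1)]
    · refine setIntegral_congr_fun measurableSet_Ioc fun ρ hρ => ?_
      have : 0 ≤ R ^ 2 - ρ ^ 2 := sub_nonneg.2 (pow_le_pow_left₀ hρ.1.le hρ.2 2)
      simp only [max_eq_right this]
    · intro ρ hρ
      have h1 : R ≤ ρ := by
        by_contra! hlt
        exact hρ.2 ⟨hρ.1, hlt.le⟩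
      have : R ^ 2 - ρ ^ 2 ≤ 0 := sub_nonpos.2 (pow_le_pow_left₀ hR.le h1 2)
      rw [max_eq_left this, zero_mul]
  · refine Continuous.integrable_of_hasCompactSupport ?_
      (hasCompactSupport_max_sub_norm_sq R).mul_left
    fun_prop

/-- The mean value property of harmonic polynomials: integrate the vanishing mean of the radial
derivative over the radius. -/
theorem sphereMean_polyFun [NeZero d] {p : MvPolynomial (Fin d) ℝ}
    (hp : polyLaplacian d p = 0) (x : 𝔼) {R : ℝ} (hR : 0 ≤ R) :
    sphereMean (polyFun p) x R = polyFun p x := by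
  have hpc : ∀ q : MvPolynomial (Fin d) ℝ, Continuous (polyFun q) := continuous_polyFun
  set N : ℝ → 𝔼 → ℝ := fun t θ => ∑ i, polyFun (MvPolynomial.pderiv i p) (x + t • θ) * θ i with hN
  have hNc : Continuous (Function.uncurry N) := by
    simp only [hN, Function.uncurry_def]; fun_prop
  have hd : ∀ θ t, HasDerivAt (fun t : ℝ => polyFun p (x + t • θ)) (N t θ) t := by
    intro θ t
    have h1 : HasDerivAt (fun t : ℝ => x + t • θ) θ t := by
      simpa using ((hasDerivAt_id t).smul_const θ).const_add x
    refine ((hasFDerivAt_polyFun p (x + t • θ)).comp_hasDerivAt t h1).congr_deriv ?_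
    simp [hN]
  have hFTC : ∀ θ, ∫ t in (0 : ℝ)..R, N t θ = polyFun p (x + R • θ) - polyFun p x := by
    intro θ
    rw [intervalIntegral.integral_eq_sub_of_hasDerivAt (fun t _ => hd θ t)]
    · simp
    · exact (hNc.comp (by fun_prop : Continuous fun t : ℝ => (t, θ))).intervalIntegrable _ _
  have hswap : ∫ θ, (∫ t in (0 : ℝ)..R, N t θ) ∂uniformSphere d =
      ∫ t in (0 : ℝ)..R, ∫ θ, N t θ ∂uniformSphere d := by
    simp_rw [intervalIntegral.integral_of_le hR]
    refine integral_integral_swap ?_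
    obtain ⟨C, hC⟩ := ((isCompact_Icc (a := (0 : ℝ)) (b := R)).prod
      (isCompact_sphere (0 : 𝔼) 1)).exists_bound_of_continuousOn hNc.continuousOn
    refine Integrable.of_bound (C := C) ?_ ?_
    · exact (hNc.comp continuous_swap).aestronglyMeasurable
    · have h1 : ∀ᵐ z ∂((uniformSphere d).prod (volume.restrict (Set.Ioc 0 R))), ‖z.1‖ = 1 :=
        Measure.quasiMeasurePreserving_fst.ae ae_norm_eq_one_uniformSphere
      have h2 : ∀ᵐ z ∂((uniformSphere d).prod (volume.restrict (Set.Ioc 0 R))),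
          z.2 ∈ Set.Ioc 0 R :=
        Measure.quasiMeasurePreserving_snd.ae (ae_restrict_mem measurableSet_Ioc)
      filter_upwards [h1, h2] with z hz1 hz2
      exact hC (z.2, z.1) ⟨⟨hz2.1.le, hz2.2⟩, by simpa using hz1⟩
  have hzero : ∫ t in (0 : ℝ)..R, ∫ θ, N t θ ∂uniformSphere d = 0 := by
    rw [intervalIntegral.integral_of_le hR]
    rw [setIntegral_congr_fun measurableSet_Ioc
      (fun t ht => integral_deriv_sphere_eq_zero hp x ht.1)]
    simp
  rw [hzero] at hswap
  simp_rw [hFTC] at hswap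
  rw [integral_sub ((hpc p).integrable_comp_sphere x hR) (integrable_const _)] at hswap
  simp only [integral_const, probReal_univ, one_smul] at hswap
  exact sub_eq_zero.1 hswap

/-- The mean value property of a linear form at the origin. -/
theorem integral_inner_uniformSphere [NeZero d] (a : 𝔼) :
    ∫ θ, inner ℝ a θ ∂uniformSphere d = 0 := by
  have h : ∀ θ : 𝔼, polyFun (∑ i, MvPolynomial.C (a i) * MvPolynomial.X i) θ = inner ℝ a θ := by
    intro θ
    simp [polyFun, PiLp.inner_apply, mul_comm]
  have := sphereMean_polyFun (p := ∑ i, MvPolynomial.C (a i) * MvPolynomial.X i) ?_ (0 : 𝔼)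
    (R := 1) zero_le_one
  · simpa [sphereMean, h] using this
  · simp [polyLaplacian_apply, MvPolynomial.pderiv_X, Pi.single_apply, apply_ite]

theorem polyLaplacian_X_mul_X (i j : Fin d) :
    polyLaplacian d (MvPolynomial.X i * MvPolynomial.X j) =
      MvPolynomial.C (if i = j then 2 else 0) := by
  have h : ∀ k i : Fin d, MvPolynomial.pderiv k (MvPolynomial.X i : MvPolynomial (Fin d) ℝ) =
      MvPolynomial.C (if i = k then 1 else 0) := by
    intro k i
    split_ifs with hik
    · rw [hik, MvPolynomial.pderiv_X_self, map_one]
    · rw [MvPolynomial.pderiv_X_of_ne hik, map_zero]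
  have h2 : ∀ k : Fin d, MvPolynomial.pderiv k (MvPolynomial.pderiv k
      (MvPolynomial.X i * MvPolynomial.X j : MvPolynomial (Fin d) ℝ)) =
      MvPolynomial.C (if i = k then if j = k then 2 else 0 else 0) := by
    intro k
    rw [MvPolynomial.pderiv_mul, h, h, map_add, MvPolynomial.pderiv_mul, MvPolynomial.pderiv_mul,
      MvPolynomial.pderiv_C, MvPolynomial.pderiv_C, h, h, zero_mul, mul_zero, zero_add, add_zero,
      ← map_mul, ← map_add]
    congr 1
    split_ifs <;> norm_num
  rw [polyLaplacian_apply]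
  simp_rw [h2]
  rw [← map_sum, Finset.sum_ite_eq]
  simp [eq_comm]

/-- The covariance of the uniform distribution on the sphere, read off from the mean value property
of the harmonic polynomials `xᵢ xⱼ` and `xₖ² - xᵢ²` at the origin. -/
theorem integral_mul_uniformSphere [NeZero d] (i j : Fin d) :
    ∫ θ, θ i * θ j ∂uniformSphere d = if i = j then (d : ℝ)⁻¹ else 0 := by
  have hint : ∀ i : Fin d, Integrable (fun θ : 𝔼 => θ i * θ i) (uniformSphere d) := by
    intro i
    have := (by fun_prop : Continuous fun θ : 𝔼 => θ i * θ i).integrable_comp_sphere 0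
      (zero_le_one (α := ℝ))
    simpa using this
  split_ifs with hij
  · subst hij
    have heq : ∀ k, ∫ θ, θ k * θ k ∂uniformSphere d = ∫ θ, θ i * θ i ∂uniformSphere d := by
      intro k
      have := sphereMean_polyFun (p := MvPolynomial.X k * MvPolynomial.X k -
        MvPolynomial.X i * MvPolynomial.X i) ?_ (0 : 𝔼) (R := 1) zero_le_one
      · simp only [sphereMean, polyFun, zero_add, one_smul, map_sub, map_mul, MvPolynomial.eval_X,
          PiLp.zero_apply, mul_zero, sub_zero] at this
        rw [integral_sub (hint k) (hint i)] at this
        exact sub_eq_zero.1 this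
      · simp [polyLaplacian_X_mul_X]
    have hsum : ∑ k, ∫ θ, θ k * θ k ∂uniformSphere d = 1 := by
      rw [← integral_finsetSum _ fun k _ => hint k]
      have : ∫ θ, ∑ k, θ k * θ k ∂uniformSphere d = ∫ θ, (1 : ℝ) ∂uniformSphere d := by
        refine integral_congr_ae ?_
        filter_upwards [ae_norm_eq_one_uniformSphere] with θ hθ
        have := EuclideanSpace.real_norm_sq_eq θ
        rw [hθ] at this
        simpa [sq] using this.symm
      rw [this]; simp
    simp only [heq, Finset.sum_const, Finset.card_univ, Fintype.card_fin, nsmul_eq_mul] at hsum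
    exact (eq_inv_of_mul_eq_one_right hsum)
  · have := sphereMean_polyFun (p := MvPolynomial.X i * MvPolynomial.X j) ?_ (0 : 𝔼)
      (R := 1) zero_le_one
    · simpa [sphereMean, polyFun] using this
    · simp [polyLaplacian_X_mul_X, hij]

/-! ### The maximum principle and the Dirichlet problem in a ball -/

theorem sphereMean_add [NeZero d] {g g' : 𝔼 → ℝ} {x : 𝔼} {ρ : ℝ}
    (hg : Integrable (fun θ => g (x + ρ • θ)) (uniformSphere d))
    (hg' : Integrable (fun θ => g' (x + ρ • θ)) (uniformSphere d)) :
    sphereMean (fun y => g y + g' y) x ρ = sphereMean g x ρ + sphereMean g' x ρ :=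
  integral_add hg hg'

theorem sphereMean_sub [NeZero d] {g g' : 𝔼 → ℝ} {x : 𝔼} {ρ : ℝ}
    (hg : Integrable (fun θ => g (x + ρ • θ)) (uniformSphere d))
    (hg' : Integrable (fun θ => g' (x + ρ • θ)) (uniformSphere d)) :
    sphereMean (fun y => g y - g' y) x ρ = sphereMean g x ρ - sphereMean g' x ρ :=
  integral_sub hg hg'

theorem sphereMean_const_mul (a : ℝ) (g : 𝔼 → ℝ) (x : 𝔼) (ρ : ℝ) :
    sphereMean (fun y => a * g y) x ρ = a * sphereMean g x ρ :=
  integral_const_mul a _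

theorem abs_sphereMean_sub_le [NeZero d] {g g' : 𝔼 → ℝ} {x : 𝔼} {ρ ε : ℝ} (hρ : 0 ≤ ρ)
    (hg : Integrable (fun θ => g (x + ρ • θ)) (uniformSphere d))
    (hg' : Integrable (fun θ => g' (x + ρ • θ)) (uniformSphere d))
    (h : ∀ y ∈ Metric.sphere x ρ, |g y - g' y| ≤ ε) :
    |sphereMean g x ρ - sphereMean g' x ρ| ≤ ε := by
  rw [← sphereMean_sub hg hg']
  have := norm_integral_le_of_norm_le_const (μ := uniformSphere d)
    (f := fun θ => g (x + ρ • θ) - g' (x + ρ • θ)) (C := ε) ?_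
  · simpa [sphereMean] using this
  · filter_upwards [ae_mem_sphere_uniformSphere x hρ] with θ hθ
    exact h _ hθ

theorem sphereMean_norm_sub_sq [NeZero d] (x c : 𝔼) (ρ : ℝ) :
    sphereMean (fun y => ‖y - c‖ ^ 2) x ρ = ‖x - c‖ ^ 2 + ρ ^ 2 := by
  have h : sphereMean (fun y => ‖y - c‖ ^ 2) x ρ =
      ∫ θ, (‖x - c‖ ^ 2 + ρ ^ 2) + (2 * ρ) * inner ℝ (x - c) θ ∂uniformSphere d := by
    refine integral_congr_ae ?_
    filter_upwards [ae_norm_eq_one_uniformSphere] with θ hθ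
    have : x + ρ • θ - c = (x - c) + ρ • θ := by abel
    simp only [this, norm_add_sq_real, norm_smul, hθ, inner_smul_right, Real.norm_eq_abs, mul_one,
      sq_abs]
    ring
  have hint : Integrable (fun θ : 𝔼 => inner ℝ (x - c) θ) (uniformSphere d) := by
    have := (by fun_prop : Continuous fun θ : 𝔼 => inner ℝ (x - c) θ).integrable_comp_sphere 0
      (zero_le_one (α := ℝ))
    simpa using this
  rw [h, integral_add (integrable_const _) (hint.const_mul _), integral_const_mul,
    integral_inner_uniformSphere]
  simp

/-- The maximum principle: a continuous function that lies below its means over all small spheres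
is bounded in a ball by its maximum on the boundary. Adding `ε |x - c|²` makes the inequality
strict, which rules out an interior maximum. -/
theorem le_zero_of_submean [NeZero d] {w : 𝔼 → ℝ} (hw : Continuous w) {c : 𝔼} {R : ℝ}
    (hsub : ∀ x ∈ Metric.ball c R, ∀ᶠ ρ in 𝓝[>] 0, w x ≤ sphereMean w x ρ)
    (hb : ∀ x ∈ Metric.sphere c R, w x ≤ 0) {x : 𝔼} (hx : x ∈ Metric.closedBall c R) :
    w x ≤ 0 := by
  by_contra! hpos
  have hR : 0 ≤ R := dist_nonneg.trans hx
  obtain ⟨ε, hε, hεR⟩ : ∃ ε > 0, ε * R ^ 2 < w x := by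
    refine ⟨w x / (R ^ 2 + 1), by positivity, ?_⟩
    rw [div_mul_eq_mul_div, div_lt_iff₀ (by positivity)]
    linarith
  set v : 𝔼 → ℝ := fun y => w y + ε * ‖y - c‖ ^ 2 with hv
  have hvc : Continuous v := by fun_prop
  obtain ⟨z, hz, hmax⟩ := (isCompact_closedBall c R).exists_isMaxOn ⟨x, hx⟩ hvc.continuousOn
  have hzpos : ε * R ^ 2 < v z := by
    have h1 : v x ≤ v z := hmax hx
    have h2 : 0 ≤ ε * ‖x - c‖ ^ 2 := by positivity
    simp only [hv] at h1 ⊢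
    linarith
  have hzb : z ∈ Metric.ball c R := by
    rw [Metric.mem_ball]
    refine lt_of_le_of_ne hz fun heq => ?_
    have h1 := hb z heq
    simp only [hv] at hzpos
    rw [dist_eq_norm] at heq
    rw [heq] at hzpos
    linarith
  obtain ⟨δ, hδ, hδs⟩ := Metric.nhds_basis_closedBall.mem_iff.1 (Metric.isOpen_ball.mem_nhds hzb)
  obtain ⟨ρ, hρ1, hρ0, hρδ⟩ : ∃ ρ, w z ≤ sphereMean w z ρ ∧ 0 < ρ ∧ ρ ≤ δ :=
    ((hsub z hzb).and (Ioc_mem_nhdsGT hδ)).exists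
  have hmean : sphereMean v z ρ = sphereMean w z ρ + ε * (‖z - c‖ ^ 2 + ρ ^ 2) := by
    rw [← sphereMean_norm_sub_sq, ← sphereMean_const_mul]
    exact sphereMean_add (hw.integrable_comp_sphere z hρ0.le)
      ((by fun_prop : Continuous fun y => ε * ‖y - c‖ ^ 2).integrable_comp_sphere z hρ0.le)
  have hle : sphereMean v z ρ ≤ v z := by
    rw [← sphereMean_const (v z) z ρ]
    refine sphereMean_mono hρ0.le (hvc.integrable_comp_sphere z hρ0.le) (integrable_const _) ?_
    intro y hy
    refine hmax (Metric.ball_subset_closedBall (hδs ?_))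
    exact Metric.closedBall_subset_closedBall hρδ (Metric.sphere_subset_closedBall hy)
  have : 0 < ε * ρ ^ 2 := by positivity
  simp only [hmean] at hle
  simp only [hv] at hle
  linarith

theorem polyFun_le_of_le_on_sphere [NeZero d] {p : MvPolynomial (Fin d) ℝ}
    (hp : polyLaplacian d p = 0) {c : 𝔼} {R M : ℝ}
    (hb : ∀ x ∈ Metric.sphere c R, polyFun p x ≤ M) {x : 𝔼} (hx : x ∈ Metric.closedBall c R) :
    polyFun p x ≤ M := by
  have hc := continuous_polyFun p
  have := le_zero_of_submean (w := fun y => polyFun p y - M) (by fun_prop) (c := c) (R := R)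
    (fun y _ => ?_) (fun y hy => sub_nonpos.2 (hb y hy)) hx
  · exact sub_nonpos.1 this
  · filter_upwards [self_mem_nhdsWithin] with ρ hρ
    rw [sphereMean_sub (hc.integrable_comp_sphere y (le_of_lt hρ)) (integrable_const _),
      sphereMean_const, sphereMean_polyFun hp y (le_of_lt hρ)]

theorem totalDegree_pderiv_le (i : Fin d) (p : MvPolynomial (Fin d) ℝ) :
    (MvPolynomial.pderiv i p).totalDegree ≤ p.totalDegree - 1 := by
  refine Finset.sup_le fun m hm => ?_
  rw [MvPolynomial.mem_support_iff, MvPolynomial.coeff_pderiv] at hm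
  have h1 : m + Finsupp.single i 1 ∈ p.support :=
    MvPolynomial.mem_support_iff.2 (left_ne_zero_of_mul hm)
  have h2 := MvPolynomial.le_totalDegree h1
  rw [Finsupp.sum_add_index' (fun _ => rfl) (fun _ _ _ => rfl),
    Finsupp.sum_single_index rfl] at h2
  exact Nat.le_sub_of_add_le h2

theorem totalDegree_polyLaplacian_le (p : MvPolynomial (Fin d) ℝ) :
    (polyLaplacian d p).totalDegree ≤ p.totalDegree - 2 := by
  rw [polyLaplacian_apply]
  refine (MvPolynomial.totalDegree_finsetSum _ _).trans (Finset.sup_le fun i _ => ?_)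
  have h1 := totalDegree_pderiv_le i p
  have h2 := totalDegree_pderiv_le i (MvPolynomial.pderiv i p)
  omega

/-- The polynomial `R² - |x - c|²`. -/
noncomputable def ballPoly (c : 𝔼) (R : ℝ) : MvPolynomial (Fin d) ℝ :=
  MvPolynomial.C (R ^ 2) - ∑ i, (MvPolynomial.X i - MvPolynomial.C (c i)) ^ 2

theorem polyFun_ballPoly (c : 𝔼) (R : ℝ) (x : 𝔼) :
    polyFun (ballPoly c R) x = R ^ 2 - ‖x - c‖ ^ 2 := by
  simp [polyFun, ballPoly, EuclideanSpace.real_norm_sq_eq]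

theorem totalDegree_ballPoly_le (c : 𝔼) (R : ℝ) : (ballPoly c R).totalDegree ≤ 2 := by
  refine (MvPolynomial.totalDegree_sub _ _).trans (max_le ?_ ?_)
  · exact (MvPolynomial.totalDegree_C _).le.trans (Nat.zero_le _)
  · refine (MvPolynomial.totalDegree_finsetSum _ _).trans (Finset.sup_le fun i _ => ?_)
    refine (MvPolynomial.totalDegree_pow _ _).trans ?_
    have : (MvPolynomial.X i - MvPolynomial.C (c i) : MvPolynomial (Fin d) ℝ).totalDegree ≤ 1 :=
      (MvPolynomial.totalDegree_sub _ _).trans (max_le (by simp) (by simp))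
    omega

theorem eq_zero_of_polyFun_eq_zero_on_ball {p : MvPolynomial (Fin d) ℝ} {c : 𝔼} {R : ℝ}
    (hR : 0 < R) (h : ∀ x ∈ Metric.ball c R, polyFun p x = 0) : p = 0 := by
  have hopen : IsOpen ((WithLp.toLp 2 : (Fin d → ℝ) → 𝔼) ⁻¹' Metric.ball c R) :=
    Metric.isOpen_ball.preimage (PiLp.continuous_toLp 2 _)
  obtain ⟨ε, hε, hsub⟩ := Metric.isOpen_iff.1 hopen c.ofLp (by simpa using hR)
  refine MvPolynomial.funext_set (fun i => Metric.ball (c i) ε) (fun i => ?_) fun x hx => ?_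
  · rw [Real.ball_eq_Ioo]
    exact Set.Ioo_infinite (by linarith)
  · have hx' : x ∈ Metric.ball c.ofLp ε := by
      rw [Metric.mem_ball, dist_pi_lt_iff hε]
      exact fun i => hx i (Set.mem_univ i)
    simpa [polyFun] using h _ (hsub hx')

/-- The Dirichlet problem in a ball with polynomial boundary data has a polynomial solution.
The map `p ↦ Δ((R² - |x - c|²) p)` does not raise the degree, and it is injective by the maximum
principle, hence it is onto the polynomials of bounded degree; subtract from the data the
polynomial `(R² - |x - c|²) p` with the same Laplacian. -/
theorem exists_harmonic_polynomial_eq_on_sphere [NeZero d] (g : MvPolynomial (Fin d) ℝ) (c : 𝔼)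
    {R : ℝ} (hR : 0 < R) : ∃ p : MvPolynomial (Fin d) ℝ, polyLaplacian d p = 0 ∧
      ∀ x ∈ Metric.sphere c R, polyFun p x = polyFun g x := by
  set n := g.totalDegree
  set q := ballPoly c R with hq
  have hqs : ∀ x ∈ Metric.sphere c R, polyFun q x = 0 := by
    intro x hx
    rw [mem_sphere_iff_norm] at hx
    rw [hq, polyFun_ballPoly, hx, sub_self]
  have hmul : ∀ p p' : MvPolynomial (Fin d) ℝ, ∀ x : 𝔼,
      polyFun (p * p') x = polyFun p x * polyFun p' x := by
    intro p p' x; simp [polyFun]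
  have hq0 : q ≠ 0 := by
    intro h0
    have := polyFun_ballPoly c R c
    rw [← hq, h0] at this
    simp [polyFun] at this
    exact (pow_pos hR 2).ne this
  let T := polyLaplacian d ∘ₗ LinearMap.mulLeft ℝ q
  have hT : ∀ p ∈ MvPolynomial.restrictTotalDegree (Fin d) ℝ n,
      T p ∈ MvPolynomial.restrictTotalDegree (Fin d) ℝ n := by
    intro p hp
    rw [MvPolynomial.mem_restrictTotalDegree] at hp ⊢
    have h1 := totalDegree_polyLaplacian_le (q * p)
    have h2 := MvPolynomial.totalDegree_mul q p
    have h3 : q.totalDegree ≤ 2 := totalDegree_ballPoly_le c R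
    change (polyLaplacian d (q * p)).totalDegree ≤ n
    omega
  have hinj : Function.Injective (T.restrict hT) := by
    rw [← LinearMap.ker_eq_bot, LinearMap.ker_eq_bot']
    rintro ⟨p, hp⟩ h0
    have h1 : polyLaplacian d (q * p) = 0 := congrArg Subtype.val h0
    have hs : ∀ x ∈ Metric.sphere c R, polyFun (q * p) x = 0 := fun x hx => by
      rw [hmul, hqs x hx, zero_mul]
    have h2 : q * p = 0 := by
      refine eq_zero_of_polyFun_eq_zero_on_ball hR (c := c) fun x hx => ?_
      have hx := Metric.ball_subset_closedBall hx
      refine le_antisymm (polyFun_le_of_le_on_sphere h1 (fun y hy => (hs y hy).le) hx) ?_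
      have h3 : polyLaplacian d (-(q * p)) = 0 := by rw [map_neg, h1, neg_zero]
      have hn : ∀ y : 𝔼, polyFun (-(q * p)) y = - polyFun (q * p) y := fun y => by simp [polyFun]
      have := polyFun_le_of_le_on_sphere h3 (M := 0) (fun y hy => by rw [hn, hs y hy, neg_zero]) hx
      rw [hn] at this
      linarith
    exact Subtype.ext ((mul_eq_zero.1 h2).resolve_left hq0)
  have hsurj := LinearMap.injective_iff_surjective.1 hinj
  have hg : polyLaplacian d g ∈ MvPolynomial.restrictTotalDegree (Fin d) ℝ n := by
    rw [MvPolynomial.mem_restrictTotalDegree]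
    exact (totalDegree_polyLaplacian_le g).trans (Nat.sub_le _ _)
  obtain ⟨⟨p, hp⟩, hpg⟩ := hsurj ⟨_, hg⟩
  have h1 : polyLaplacian d (q * p) = polyLaplacian d g := congrArg Subtype.val hpg
  refine ⟨g - q * p, by rw [map_sub, h1, sub_self], fun x hx => ?_⟩
  have : polyFun (g - q * p) x = polyFun g x - polyFun (q * p) x := by simp [polyFun]
  rw [this, hmul, hqs x hx, zero_mul, sub_zero]

/-- The Stone–Weierstrass theorem for polynomials in several variables. -/
theorem exists_polyFun_near_on_compact {K : Set 𝔼} (hK : IsCompact K) {w : 𝔼 → ℝ}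
    (hw : ContinuousOn w K) {ε : ℝ} (hε : 0 < ε) :
    ∃ g : MvPolynomial (Fin d) ℝ, ∀ x ∈ K, |polyFun g x - w x| < ε := by
  have : CompactSpace K := isCompact_iff_compactSpace.1 hK
  let φ : MvPolynomial (Fin d) ℝ →ₐ[ℝ] C(K, ℝ) := MvPolynomial.aeval fun i =>
    ⟨fun x : K => (x : 𝔼) i, by fun_prop⟩
  have hφ : ∀ g, ∀ x : K, φ g x = polyFun g x := by
    intro g x
    induction g using MvPolynomial.induction_on with
    | C a => simp [φ, polyFun]
    | add p q hp hq => simp [hp, hq, polyFun]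
    | mul_X p i hp =>
      rw [map_mul, ContinuousMap.mul_apply, hp]
      simp [φ, polyFun]
  have hsep : φ.range.SeparatesPoints := by
    intro x y hxy
    have : ∃ i, (x : 𝔼) i ≠ (y : 𝔼) i := by
      by_contra! h
      exact hxy (Subtype.ext (PiLp.ext h))
    obtain ⟨i, hi⟩ := this
    refine ⟨_, ⟨φ (MvPolynomial.X i), ⟨_, rfl⟩, rfl⟩, ?_⟩
    simpa [hφ, polyFun] using hi
  have htop := ContinuousMap.subalgebra_topologicalClosure_eq_top_of_separatesPoints _ hsep
  have hmem : (⟨K.domRestrict w, hw.domRestrict⟩ : C(K, ℝ)) ∈ φ.range.topologicalClosure := by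
    rw [htop]; trivial
  obtain ⟨_, ⟨g, rfl⟩, hgd⟩ := Metric.mem_closure_iff.1 hmem ε hε
  refine ⟨g, fun x hx => ?_⟩
  have := (ContinuousMap.dist_apply_le_dist (⟨x, hx⟩ : K)).trans_lt hgd
  rw [dist_comm, Real.dist_eq] at this
  have h2 : polyFun g x = φ g ⟨x, hx⟩ := (hφ g ⟨x, hx⟩).symm
  rw [h2]
  exact this

/-- Solution of the Dirichlet problem in a ball: a continuous function can be changed inside a ball
so that it becomes harmonic there (in the sense of the mean value property) and stays
continuous. -/
theorem exists_harmonic_lift [NeZero d] {w : 𝔼 → ℝ} (hw : Continuous w) (c : 𝔼) {R : ℝ}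
    (hR : 0 < R) : ∃ L : 𝔼 → ℝ, Continuous L ∧ (∀ x, x ∉ Metric.ball c R → L x = w x) ∧
      ∀ x ρ, 0 ≤ ρ → Metric.closedBall x ρ ⊆ Metric.closedBall c R → sphereMean L x ρ = L x := by
  -- Harmonic polynomials `p n` approximating `w` on the sphere are uniformly Cauchy in the ball, by
  -- the maximum principle.
  have hex : ∀ n : ℕ, ∃ p : MvPolynomial (Fin d) ℝ, polyLaplacian d p = 0 ∧
      ∀ x ∈ Metric.sphere c R, |polyFun p x - w x| < 1 / ((n : ℝ) + 1) := by
    intro n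
    obtain ⟨g, hg⟩ := exists_polyFun_near_on_compact (isCompact_sphere c R) hw.continuousOn
      (Nat.one_div_pos_of_nat (α := ℝ) (n := n))
    obtain ⟨p, hp, hpg⟩ := exists_harmonic_polynomial_eq_on_sphere g c hR
    exact ⟨p, hp, fun x hx => by rw [hpg x hx]; exact hg x hx⟩
  choose p hp hpw using hex
  have hle : ∀ m n : ℕ, ∀ x ∈ Metric.closedBall c R,
      polyFun (p m) x - polyFun (p n) x ≤ 1 / ((m : ℝ) + 1) + 1 / ((n : ℝ) + 1) := by
    intro m n x hx
    have hs : ∀ y : 𝔼, polyFun (p m - p n) y = polyFun (p m) y - polyFun (p n) y := by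
      intro y; simp [polyFun]
    rw [← hs]
    refine polyFun_le_of_le_on_sphere (by rw [map_sub, hp, hp, sub_zero]) (fun y hy => ?_) hx
    rw [hs]
    have h1 := abs_lt.1 (hpw m y hy)
    have h2 := abs_lt.1 (hpw n y hy)
    linarith
  have habs : ∀ m n : ℕ, ∀ x ∈ Metric.closedBall c R,
      |polyFun (p m) x - polyFun (p n) x| ≤ 1 / ((m : ℝ) + 1) + 1 / ((n : ℝ) + 1) := by
    intro m n x hx
    rw [abs_le]
    have h1 := hle m n x hx
    have h2 := hle n m x hx
    constructor <;> linarith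
  have hlim0 : Tendsto (fun n : ℕ => 1 / ((n : ℝ) + 1)) atTop (𝓝 0) :=
    tendsto_one_div_add_atTop_nhds_zero_nat
  have hlim : ∀ x ∈ Metric.closedBall c R, ∃ l, Tendsto (fun n => polyFun (p n) x) atTop (𝓝 l) := by
    intro x hx
    refine cauchySeq_tendsto_of_complete (cauchySeq_of_le_tendsto_0
      (fun n : ℕ => 1 / ((n : ℝ) + 1) + 1 / ((n : ℝ) + 1)) (fun m n N hm hn => ?_) ?_)
    · rw [Real.dist_eq]
      refine (habs m n x hx).trans (add_le_add ?_ ?_)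
      · exact Nat.one_div_le_one_div hm
      · exact Nat.one_div_le_one_div hn
    · simpa using hlim0.add hlim0
  choose! P hP using hlim
  have hnear : ∀ n : ℕ, ∀ x ∈ Metric.closedBall c R,
      |polyFun (p n) x - P x| ≤ 1 / ((n : ℝ) + 1) := by
    intro n x hx
    have h1 : Tendsto (fun m => |polyFun (p n) x - polyFun (p m) x|) atTop
        (𝓝 |polyFun (p n) x - P x|) := ((hP x hx).const_sub _).abs
    have h2 : Tendsto (fun m : ℕ => 1 / ((n : ℝ) + 1) + 1 / ((m : ℝ) + 1)) atTop
        (𝓝 (1 / ((n : ℝ) + 1) + 0)) := hlim0.const_add _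
    rw [add_zero] at h2
    exact le_of_tendsto_of_tendsto' h1 h2 fun m => habs n m x hx
  have hunif : TendstoUniformlyOn (fun n => polyFun (p n)) P atTop (Metric.closedBall c R) := by
    rw [Metric.tendstoUniformlyOn_iff]
    intro ε hε
    filter_upwards [hlim0.eventually_lt_const hε] with n hn x hx
    rw [dist_comm, Real.dist_eq]
    exact (hnear n x hx).trans_lt hn
  have hPc : ContinuousOn P (Metric.closedBall c R) :=
    hunif.continuousOn (Frequently.of_forall fun n => (continuous_polyFun _).continuousOn)
  have hPs : ∀ x ∈ Metric.sphere c R, P x = w x := by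
    intro x hx
    refine tendsto_nhds_unique (hP x (Metric.sphere_subset_closedBall hx)) ?_
    rw [tendsto_iff_dist_tendsto_zero]
    refine squeeze_zero (fun _ => dist_nonneg) (fun n => ?_) hlim0
    rw [Real.dist_eq]
    exact (hpw n x hx).le
  classical
  set L : 𝔼 → ℝ := fun x => if x ∈ Metric.closedBall c R then P x else w x with hL
  have hLP : ∀ x ∈ Metric.closedBall c R, L x = P x := fun x hx => if_pos hx
  have hLw : ∀ x, x ∉ Metric.ball c R → L x = w x := by
    intro x hx
    by_cases hx' : x ∈ Metric.closedBall c R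
    · rw [hLP x hx']
      refine hPs x (le_antisymm hx' ?_)
      simpa using hx
    · exact if_neg hx'
  have hLc : Continuous L := by
    rw [← continuousOn_univ]
    have hu : (Set.univ : Set 𝔼) = Metric.closedBall c R ∪ (Metric.ball c R)ᶜ := by
      refine (Set.eq_univ_of_forall fun x => ?_).symm
      by_cases hx : x ∈ Metric.ball c R
      · exact Or.inl (Metric.ball_subset_closedBall hx)
      · exact Or.inr hx
    rw [hu]
    refine ContinuousOn.union_of_isClosed (hPc.congr hLP) (hw.continuousOn.congr fun x hx => ?_)
      Metric.isClosed_closedBall Metric.isOpen_ball.isClosed_compl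
    exact hLw x hx
  refine ⟨L, hLc, hLw, fun x ρ hρ hsub => ?_⟩
  have hx : x ∈ Metric.closedBall c R := hsub (Metric.mem_closedBall_self hρ)
  refine tendsto_nhds_unique (f := fun n => polyFun (p n) x) (l := atTop) ?_ ?_
  · rw [tendsto_iff_dist_tendsto_zero]
    refine squeeze_zero (fun _ => dist_nonneg) (fun n => ?_) hlim0
    rw [Real.dist_eq, ← sphereMean_polyFun (hp n) x hρ]
    refine abs_sphereMean_sub_le hρ ((continuous_polyFun _).integrable_comp_sphere x hρ)
      (hLc.integrable_comp_sphere x hρ) fun y hy => ?_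
    have hy := hsub (Metric.sphere_subset_closedBall hy)
    rw [hLP y hy]
    exact hnear n y hy
  · rw [hLP x hx]
    exact hP x hx

theorem eventually_sphereMean_eq_of_mem_ball {L : 𝔼 → ℝ} {c : 𝔼} {R : ℝ}
    (hL : ∀ x ρ, 0 ≤ ρ → Metric.closedBall x ρ ⊆ Metric.closedBall c R → sphereMean L x ρ = L x)
    {x : 𝔼} (hx : x ∈ Metric.ball c R) : ∀ᶠ ρ in 𝓝[>] 0, sphereMean L x ρ = L x := by
  obtain ⟨δ, hδ, hδs⟩ := Metric.nhds_basis_closedBall.mem_iff.1 (Metric.isOpen_ball.mem_nhds hx)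
  filter_upwards [Ioc_mem_nhdsGT hδ] with ρ hρ
  exact hL x ρ hρ.1.le (((Metric.closedBall_subset_closedBall hρ.2).trans hδs).trans
    Metric.ball_subset_closedBall)

/-- By the maximum principle, a subharmonic function lies below its harmonic lift. -/
theorem le_harmonic_lift_of_submean [NeZero d] {w L : 𝔼 → ℝ} (hw : Continuous w)
    (hLc : Continuous L) {c : 𝔼} {R : ℝ}
    (hsub : ∀ x ∈ Metric.ball c R, ∀ᶠ ρ in 𝓝[>] 0, w x ≤ sphereMean w x ρ)
    (hLw : ∀ x, x ∉ Metric.ball c R → L x = w x)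
    (hL : ∀ x ρ, 0 ≤ ρ → Metric.closedBall x ρ ⊆ Metric.closedBall c R → sphereMean L x ρ = L x)
    (x : 𝔼) : w x ≤ L x := by
  by_cases hx : x ∈ Metric.ball c R
  · refine sub_nonpos.1 (le_zero_of_submean (w := fun y => w y - L y) (by fun_prop) ?_ ?_
      (Metric.ball_subset_closedBall hx))
    · intro y hy
      filter_upwards [hsub y hy, eventually_sphereMean_eq_of_mem_ball hL hy,
        self_mem_nhdsWithin] with ρ h1 h2 h3
      rw [sphereMean_sub (hw.integrable_comp_sphere y (le_of_lt h3))
        (hLc.integrable_comp_sphere y (le_of_lt h3)), h2]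
      linarith
    · intro y hy
      have : y ∉ Metric.ball c R := by
        rw [Metric.mem_ball, hy]; exact lt_irrefl R
      rw [hLw y this, sub_self]
  · exact (hLw x hx).ge

/-- The mean value inequality over small spheres extends to large ones, by comparison with the
harmonic function that has the same values on the large sphere. -/
theorem le_sphereMean_of_submean [NeZero d] {w : 𝔼 → ℝ} (hw : Continuous w) {c : 𝔼} {R : ℝ}
    (hR : 0 < R) (hsub : ∀ x ∈ Metric.ball c R, ∀ᶠ ρ in 𝓝[>] 0, w x ≤ sphereMean w x ρ) :
    w c ≤ sphereMean w c R := by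
  obtain ⟨L, hLc, hLw, hL⟩ := exists_harmonic_lift hw c hR
  refine (le_harmonic_lift_of_submean hw hLc hsub hLw hL c).trans_eq ?_
  rw [← hL c R hR.le subset_rfl]
  refine sphereMean_congr hR.le fun y hy => hLw y ?_
  rw [Metric.mem_ball, hy]
  exact lt_irrefl R

/-! ### Sweeping out -/

/-- `w` is a continuous function, equal to `u` outside `V`, lying above `u`, and subharmonic in `V`
in the sense that it lies below its means over all small spheres. -/
structure IsSubharmonicAbove (V : Set 𝔼) (u w : 𝔼 → ℝ) : Prop where
  continuous : Continuous w
  submean : ∀ x ∈ V, ∀ᶠ ρ in 𝓝[>] 0, w x ≤ sphereMean w x ρ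
  le : ∀ x, u x ≤ w x
  eq_of_notMem : ∀ x, x ∉ V → w x = u x

/-- The harmonic lift in a ball inside `V` is again subharmonic: at points outside the open ball the
value is unchanged while the means have not decreased. -/
theorem IsSubharmonicAbove.exists_lift [NeZero d] {V : Set 𝔼} {u w : 𝔼 → ℝ}
    (hw : IsSubharmonicAbove V u w) {c : 𝔼} {R : ℝ} (hR : 0 < R)
    (hV : Metric.closedBall c R ⊆ V) : ∃ w', IsSubharmonicAbove V u w' ∧ (∀ x, w x ≤ w' x) ∧
      ∀ x ρ, 0 ≤ ρ → Metric.closedBall x ρ ⊆ Metric.closedBall c R →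
        sphereMean w' x ρ = w' x := by
  obtain ⟨L, hLc, hLw, hL⟩ := exists_harmonic_lift hw.continuous c hR
  have hbV : Metric.ball c R ⊆ V := Metric.ball_subset_closedBall.trans hV
  have hle := le_harmonic_lift_of_submean hw.continuous hLc (fun x hx => hw.submean x (hbV hx))
    hLw hL
  refine ⟨L, ⟨hLc, fun x hx => ?_, fun x => (hw.le x).trans (hle x), fun x hx => ?_⟩, hle, hL⟩
  · by_cases hxb : x ∈ Metric.ball c R
    · filter_upwards [eventually_sphereMean_eq_of_mem_ball hL hxb] with ρ hρ using hρ.ge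
    · filter_upwards [hw.submean x hx, self_mem_nhdsWithin] with ρ hρ hρ0
      rw [hLw x hxb]
      exact hρ.trans (sphereMean_mono (le_of_lt hρ0)
        (hw.continuous.integrable_comp_sphere x (le_of_lt hρ0))
        (hLc.integrable_comp_sphere x (le_of_lt hρ0)) fun y _ => hle y)
  · rw [hLw x fun h => hx (hbV h), hw.eq_of_notMem x hx]

/-- Countably many closed balls in `V` suffice to contain every closed ball in `V`. -/
theorem exists_ball_mem_denseSeq {V : Set 𝔼} (hV : IsOpen V) {x : 𝔼} {ρ : ℝ} (hρ : 0 ≤ ρ)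
    (hx : Metric.closedBall x ρ ⊆ V) : ∃ k : ℕ, ∃ z : 𝔼 × ℝ,
      TopologicalSpace.denseSeq (𝔼 × ℝ) k = z ∧ 0 < z.2 ∧ Metric.closedBall z.1 z.2 ⊆ V ∧
      Metric.closedBall x ρ ⊆ Metric.closedBall z.1 z.2 := by
  obtain ⟨δ, hδ, hδV⟩ := (isCompact_closedBall x ρ).exists_cthickening_subset_open hV hx
  rw [cthickening_closedBall hδ.le hρ] at hδV
  obtain ⟨k, hk⟩ := (TopologicalSpace.denseRange_denseSeq (𝔼 × ℝ)).exists_mem_open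
    (Metric.isOpen_ball (x := (x, ρ + δ / 2)) (ε := δ / 6))
    ⟨_, Metric.mem_ball_self (by positivity)⟩
  refine ⟨k, _, rfl, ?_⟩
  set z := TopologicalSpace.denseSeq (𝔼 × ℝ) k
  rw [Metric.mem_ball, Prod.dist_eq, max_lt_iff, Real.dist_eq, abs_lt] at hk
  obtain ⟨h1, h2, h3⟩ := hk
  simp only at h1 h2 h3
  refine ⟨by linarith, (Metric.closedBall_subset_closedBall' ?_).trans hδV,
    Metric.closedBall_subset_closedBall' ?_⟩
  · linarith
  · rw [dist_comm]; linarith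

/-- Poincaré's sweeping-out sequence: lift successively in countably many balls, each of which
recurs infinitely often. -/
theorem exists_balayage_seq [NeZero d] {V : Set 𝔼} (hV : IsOpen V) {u : 𝔼 → ℝ}
    (hu : IsSubharmonicAbove V u u) : ∃ w : ℕ → 𝔼 → ℝ, (∀ n, IsSubharmonicAbove V u (w n)) ∧
      (∀ x, Monotone fun n => w n x) ∧
      ∀ x ρ, 0 ≤ ρ → Metric.closedBall x ρ ⊆ V → ∃ᶠ n in atTop, sphereMean (w n) x ρ = w n x := by
  -- A step does nothing when the given ball is degenerate or not contained in `V`.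
  have hstep : ∀ (z : 𝔼 × ℝ) (w : {w // IsSubharmonicAbove V u w}),
      ∃ w' : {w // IsSubharmonicAbove V u w}, (∀ x, w.1 x ≤ w'.1 x) ∧
      (0 < z.2 → Metric.closedBall z.1 z.2 ⊆ V → ∀ x ρ, 0 ≤ ρ →
        Metric.closedBall x ρ ⊆ Metric.closedBall z.1 z.2 → sphereMean w'.1 x ρ = w'.1 x) := by
    intro z w
    by_cases hz : 0 < z.2 ∧ Metric.closedBall z.1 z.2 ⊆ V
    · obtain ⟨w', hw', hle, hm⟩ := w.2.exists_lift hz.1 hz.2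
      exact ⟨⟨w', hw'⟩, hle, fun _ _ => hm⟩
    · exact ⟨w, fun _ => le_rfl, fun h1 h2 => absurd ⟨h1, h2⟩ hz⟩
  choose S hSle hSm using hstep
  let W : ℕ → {w // IsSubharmonicAbove V u w} := fun n => Nat.rec ⟨u, hu⟩
    (fun n w => S (TopologicalSpace.denseSeq (𝔼 × ℝ) n.unpair.1) w) n
  refine ⟨fun n => (W n).1, fun n => (W n).2, fun x => monotone_nat_of_le_succ fun n =>
    hSle _ _ x, fun x ρ hρ hx => ?_⟩
  obtain ⟨k, z, hkz, hz0, hzV, hxz⟩ := exists_ball_mem_denseSeq hV hρ hx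
  rw [frequently_atTop]
  intro m
  refine ⟨Nat.pair k m + 1, (Nat.right_le_pair k m).trans (Nat.le_succ _), ?_⟩
  have h1 : W (Nat.pair k m + 1) = S z (W (Nat.pair k m)) := by
    rw [← hkz]
    change S (TopologicalSpace.denseSeq (𝔼 × ℝ) (Nat.pair k m).unpair.1) _ = _
    rw [Nat.unpair_pair]
  simp only [h1]
  exact hSm z _ hz0 hzV x ρ hρ hxz

/-- The supremum `H` of the sweeping-out sequence. It has the mean value property over every sphere
in `V` because infinitely many members of the sequence do, and passage to the limit is dominated. -/
theorem exists_balayage [NeZero d] {V : Set 𝔼} (hV : IsOpen V) (hVb : Bornology.IsBounded V)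
    {u : 𝔼 → ℝ} (hu : IsSubharmonicAbove V u u) {h : 𝔼 → ℝ} {C : ℝ}
    (hh : ∀ w, IsSubharmonicAbove V u w → ∀ x ∈ V, w x ≤ h x) (hC : ∀ x ∈ V, h x ≤ C) :
    ∃ H : 𝔼 → ℝ, Measurable H ∧ (∀ x ∈ V, u x ≤ H x ∧ H x ≤ h x) ∧
      (∃ C', ∀ x ∈ V, |H x| ≤ C') ∧
      ∀ x ρ, 0 ≤ ρ → Metric.closedBall x ρ ⊆ V → sphereMean H x ρ = H x := by
  obtain ⟨w, hw, hmono, hmean⟩ := exists_balayage_seq hV hu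
  obtain ⟨A, hA⟩ := hVb.isCompact_closure.exists_bound_of_continuousOn hu.continuous.continuousOn
  have hAl : ∀ x ∈ V, -A ≤ u x := fun x hx => (abs_le.1 (hA x (subset_closure hx))).1
  have hbdd : ∀ x, BddAbove (Set.range fun n => w n x) := by
    intro x
    by_cases hx : x ∈ V
    · refine ⟨h x, ?_⟩
      rintro _ ⟨n, rfl⟩
      exact hh _ (hw n) x hx
    · refine ⟨u x, ?_⟩
      rintro _ ⟨n, rfl⟩
      exact ((hw n).eq_of_notMem x hx).le
  set H : 𝔼 → ℝ := fun x => ⨆ n, w n x with hH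
  have hlim : ∀ x, Tendsto (fun n => w n x) atTop (𝓝 (H x)) := fun x =>
    tendsto_atTop_ciSup (hmono x) (hbdd x)
  have hHm : Measurable H := measurable_of_tendsto_metrizable
    (fun n => (hw n).continuous.measurable) (tendsto_pi_nhds.2 hlim)
  have hle : ∀ x ∈ V, H x ≤ h x := fun x hx => ciSup_le fun n => hh _ (hw n) x hx
  have hge : ∀ x, u x ≤ H x := fun x => ((hw 0).le x).trans (le_ciSup (hbdd x) 0)
  have hwb : ∀ n, ∀ x ∈ V, |w n x| ≤ max A C := by
    intro n x hx
    rw [abs_le]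
    have h1 := hAl x hx
    have h2 := (hw n).le x
    have h3 := (hh _ (hw n) x hx).trans (hC x hx)
    exact ⟨(neg_le_neg (le_max_left A C)).trans (h1.trans h2), h3.trans (le_max_right _ _)⟩
  refine ⟨H, hHm, fun x hx => ⟨hge x, hle x hx⟩, ⟨max A C, fun x hx => ?_⟩, fun x ρ hρ hx => ?_⟩
  · exact le_of_tendsto' (hlim x).abs fun n => hwb n x hx
  · have hxV : x ∈ V := hx (Metric.mem_closedBall_self hρ)
    have h1 : Tendsto (fun n => sphereMean (w n) x ρ) atTop (𝓝 (sphereMean H x ρ)) := by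
      refine tendsto_integral_of_dominated_convergence (fun _ => max A C)
        (fun n => ((hw n).continuous.integrable_comp_sphere x hρ).aestronglyMeasurable)
        (integrable_const _) (fun n => ?_) (Eventually.of_forall fun θ => hlim _)
      filter_upwards [ae_mem_sphere_uniformSphere x hρ] with θ hθ
      exact hwb n _ (hx (Metric.sphere_subset_closedBall hθ))
    exact tendsto_nhds_unique_of_frequently_eq h1 (hlim x) (hmean x ρ hρ hx)

/-! ### The random walk -/

section

variable {V : Set (EuclideanSpace ℝ (Fin d))}

theorem ball_infDist_frontier_subset (hV : IsOpen V) {x : 𝔼} (hx : x ∈ V) :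
    Metric.ball x (Metric.infDist x (frontier V)) ⊆ V := by
  intro y hy
  have hpos : 0 < Metric.infDist x (frontier V) := dist_nonneg.trans_lt hy
  have hdisj : Metric.ball x (Metric.infDist x (frontier V)) ⊆ (frontier V)ᶜ :=
    Metric.ball_infDist_subset_compl
  refine (convex_ball x _).isPreconnected.subset_left_of_subset_union hV
    isClosed_closure.isOpen_compl (v := (closure V)ᶜ) ?_ ?_ ⟨x, Metric.mem_ball_self hpos, hx⟩ hy
  · exact Set.disjoint_compl_right_iff_subset.2 subset_closure
  · intro z hz
    by_cases hzV : z ∈ V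
    · exact Or.inl hzV
    · refine Or.inr fun hzc => hdisj hz ?_
      rw [hV.frontier_eq]
      exact ⟨hzc, hzV⟩

theorem nonempty_frontier_of_isBounded [NeZero d] (hVne : V.Nonempty)
    (hVb : Bornology.IsBounded V) : (frontier V).Nonempty := by
  rw [Set.nonempty_iff_ne_empty]
  intro h
  rcases isClopen_iff.1 (isClopen_iff_frontier_eq_empty.2 h) with h | h
  · exact hVne.ne_empty h
  · rw [h] at hVb
    exact NormedSpace.unbounded_univ ℝ 𝔼 hVb

theorem infDist_frontier_pos (hV : IsOpen V) (hF : (frontier V).Nonempty) {x : 𝔼} (hx : x ∈ V) :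
    0 < Metric.infDist x (frontier V) := by
  refine (isClosed_frontier.notMem_iff_infDist_pos hF).1 fun h => ?_
  rw [hV.frontier_eq] at h
  exact h.2 hx

theorem closedBall_mul_infDist_subset (hV : IsOpen V) (hF : (frontier V).Nonempty) {r : ℝ}
    (hr1 : r < 1) {x : 𝔼} (hx : x ∈ V) :
    Metric.closedBall x (r * Metric.infDist x (frontier V)) ⊆ V := by
  refine (Metric.closedBall_subset_ball ?_).trans (ball_infDist_frontier_subset hV hx)
  have := infDist_frontier_pos hV hF hx
  nlinarith

variable {Ω : Type*} {ϑ : ℕ → Ω → EuclideanSpace ℝ (Fin d)} {r : ℝ}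
  {v : EuclideanSpace ℝ (Fin d)}

theorem measurable_sphereWalk_of_lt {m : MeasurableSpace Ω} (n : ℕ)
    (h : ∀ k < n, Measurable[m] (ϑ k)) : Measurable[m] (sphereWalk V ϑ r v n) := by
  induction n with
  | zero => exact measurable_const
  | succ n ih =>
    have ih := ih fun k hk => h k (hk.trans (Nat.lt_succ_self n))
    have hd : Measurable[m] fun ω =>
        r * Metric.infDist (sphereWalk V ϑ r v n ω) (frontier V) :=
      (Metric.continuous_infDist_pt _).measurable.comp ih |>.const_mul r
    exact ih.add (hd.smul (h n (Nat.lt_succ_self n)))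

theorem sphereWalk_mem (hV : IsOpen V) (hF : (frontier V).Nonempty) (hv : v ∈ V)
    (hr0 : 0 < r) (hr1 : r < 1) {ω : Ω} (hω : ∀ n, ‖ϑ n ω‖ = 1) (n : ℕ) :
    sphereWalk V ϑ r v n ω ∈ V := by
  induction n with
  | zero => exact hv
  | succ n ih =>
    refine closedBall_mul_infDist_subset hV hF hr1 ih ?_
    have : 0 ≤ Metric.infDist (sphereWalk V ϑ r v n ω) (frontier V) := Metric.infDist_nonneg
    simp [sphereWalk, norm_smul, hω, abs_of_pos hr0, abs_of_nonneg this]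

variable [MeasurableSpace Ω]

/-- The random variables `ϑ n` are independent and uniformly distributed on the unit sphere. -/
structure IsUniformSteps (P : Measure Ω) (ϑ : ℕ → Ω → 𝔼) : Prop where
  measurable : ∀ n, Measurable (ϑ n)
  iIndepFun : iIndepFun ϑ P
  map_eq : ∀ n, P.map (ϑ n) = uniformSphere d

variable {P : Measure Ω}

theorem IsUniformSteps.ae_norm_eq_one (h : IsUniformSteps P ϑ) : ∀ᵐ ω ∂P, ∀ n, ‖ϑ n ω‖ = 1 := by
  rw [ae_all_iff]
  intro n
  have := ae_norm_eq_one_uniformSphere (d := d)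
  rw [← h.map_eq n] at this
  exact ae_of_ae_map (h.measurable n).aemeasurable this

theorem IsUniformSteps.measurable_sphereWalk (h : IsUniformSteps P ϑ) (n : ℕ) :
    Measurable (sphereWalk V ϑ r v n) :=
  measurable_sphereWalk_of_lt n fun k _ => h.measurable k

/-- The filtration generated by the steps; its `n`-th member makes `ϑ 0, …, ϑ n` measurable. -/
noncomputable def IsUniformSteps.filtration (h : IsUniformSteps P ϑ) :
    Filtration ℕ (inferInstance : MeasurableSpace Ω) :=
  Filtration.natural ϑ fun n => (h.measurable n).stronglyMeasurable

/-- The position after `n + 1` steps is determined by the steps `ϑ 0, …, ϑ n`. -/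
theorem IsUniformSteps.measurable_sphereWalk_succ (h : IsUniformSteps P ϑ) (n : ℕ) :
    Measurable[h.filtration n] (sphereWalk V ϑ r v (n + 1)) := by
  refine measurable_sphereWalk_of_lt _ fun k hk => ?_
  have h1 : MeasurableSpace.comap (ϑ k) inferInstance ≤ h.filtration n :=
    le_iSup₂_of_le k (Nat.lt_succ_iff.1 hk) le_rfl
  exact measurable_iff_comap_le.2 h1

theorem IsUniformSteps.indepFun_sphereWalk [IsProbabilityMeasure P] (h : IsUniformSteps P ϑ)
    (n : ℕ) : IndepFun (sphereWalk V ϑ r v n) (ϑ n) P := by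
  cases n with
  | zero => exact indepFun_const_left v _
  | succ n =>
    have := h.iIndepFun.indep_comap_natural_of_lt
      (fun n => (h.measurable n).stronglyMeasurable) (Nat.lt_succ_self n)
    exact indep_of_indep_of_le_left this.symm
      (measurable_iff_comap_le.1 (h.measurable_sphereWalk_succ n))

theorem integrable_comp_sphereWalk [IsProbabilityMeasure P] (h : IsUniformSteps P ϑ)
    (hV : IsOpen V) (hF : (frontier V).Nonempty) (hv : v ∈ V) (hr0 : 0 < r) (hr1 : r < 1)
    {g : 𝔼 → ℝ} (hg : Measurable g) {C : ℝ} (hC : ∀ x ∈ V, |g x| ≤ C) (n : ℕ) :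
    Integrable (fun ω => g (sphereWalk V ϑ r v n ω)) P := by
  refine Integrable.of_bound (C := C) (hg.comp (h.measurable_sphereWalk n)).aestronglyMeasurable ?_
  filter_upwards [h.ae_norm_eq_one] with ω hω
  exact hC _ (sphereWalk_mem hV hF hv hr0 hr1 hω n)

/-- The Markov property of the walk for a single step. -/
theorem integral_sphereWalk_succ [NeZero d] [IsProbabilityMeasure P] (h : IsUniformSteps P ϑ)
    (hV : IsOpen V) (hF : (frontier V).Nonempty) (hv : v ∈ V) (hr0 : 0 < r) (hr1 : r < 1)
    {g : 𝔼 → ℝ} (hg : Measurable g) {C : ℝ} (hC : ∀ x ∈ V, |g x| ≤ C) (n : ℕ) :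
    Integrable (fun ω => sphereMean g (sphereWalk V ϑ r v n ω)
      (r * Metric.infDist (sphereWalk V ϑ r v n ω) (frontier V))) P ∧
    ∫ ω, g (sphereWalk V ϑ r v (n + 1) ω) ∂P =
      ∫ ω, sphereMean g (sphereWalk V ϑ r v n ω)
        (r * Metric.infDist (sphereWalk V ϑ r v n ω) (frontier V)) ∂P := by
  set X := sphereWalk V ϑ r v n
  have hXm : Measurable X := h.measurable_sphereWalk n
  set G : 𝔼 × 𝔼 → ℝ := fun z => g (z.1 + (r * Metric.infDist z.1 (frontier V)) • z.2)
  have hGm : Measurable G := by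
    have : Measurable fun z : 𝔼 × 𝔼 => Metric.infDist z.1 (frontier V) :=
      (Metric.continuous_infDist_pt _).measurable.comp measurable_fst
    exact hg.comp (measurable_fst.add ((this.const_mul r).smul measurable_snd))
  have hmap : P.map (fun ω => (X ω, ϑ n ω)) = (P.map X).prod (uniformSphere d) := by
    rw [← h.map_eq n]
    exact (indepFun_iff_map_prod_eq_prod_map_map hXm.aemeasurable
      (h.measurable n).aemeasurable).1 (h.indepFun_sphereWalk n)
  have hpair : AEMeasurable (fun ω => (X ω, ϑ n ω)) P :=
    (hXm.prodMk (h.measurable n)).aemeasurable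
  have : IsProbabilityMeasure (P.map X) := Measure.isProbabilityMeasure_map hXm.aemeasurable
  have hint : Integrable G ((P.map X).prod (uniformSphere d)) := by
    rw [← hmap, integrable_map_measure hGm.aestronglyMeasurable hpair]
    exact integrable_comp_sphereWalk h hV hF hv hr0 hr1 hg hC (n + 1)
  have hI := hint.integral_prod_left
  refine ⟨hI.comp_measurable hXm, ?_⟩
  calc ∫ ω, g (sphereWalk V ϑ r v (n + 1) ω) ∂P
      = ∫ z, G z ∂(P.map (fun ω => (X ω, ϑ n ω))) :=
        (integral_map hpair hGm.aestronglyMeasurable).symm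
    _ = ∫ x, ∫ θ, G (x, θ) ∂uniformSphere d ∂(P.map X) := by rw [hmap, integral_prod _ hint]
    _ = _ := integral_map hXm.aemeasurable hI.aestronglyMeasurable

/-- Along the walk, the expectation of a function below its means over the spheres used by the walk
does not decrease. -/
theorem le_integral_sphereWalk [NeZero d] [IsProbabilityMeasure P] (h : IsUniformSteps P ϑ)
    (hV : IsOpen V) (hF : (frontier V).Nonempty) (hv : v ∈ V) (hr0 : 0 < r) (hr1 : r < 1)
    {g : 𝔼 → ℝ} (hg : Measurable g) {C : ℝ} (hC : ∀ x ∈ V, |g x| ≤ C)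
    (hsub : ∀ x ∈ V, g x ≤ sphereMean g x (r * Metric.infDist x (frontier V))) (n : ℕ) :
    g v ≤ ∫ ω, g (sphereWalk V ϑ r v n ω) ∂P := by
  induction n with
  | zero => simp [sphereWalk]
  | succ n ih =>
    obtain ⟨h1, h2⟩ := integral_sphereWalk_succ h hV hF hv hr0 hr1 hg hC n
    rw [h2]
    refine ih.trans (integral_mono_ae
      (integrable_comp_sphereWalk h hV hF hv hr0 hr1 hg hC n) h1 ?_)
    filter_upwards [h.ae_norm_eq_one] with ω hω
    exact hsub _ (sphereWalk_mem hV hF hv hr0 hr1 hω n)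

theorem integral_coord_uniformSphere [NeZero d] (i : Fin d) :
    ∫ θ, θ i ∂uniformSphere d = 0 := by
  simpa [EuclideanSpace.inner_single_left] using
    integral_inner_uniformSphere (EuclideanSpace.single i (1 : ℝ))

/-- Each coordinate of the walk is a bounded martingale, hence converges almost surely. -/
theorem ae_exists_tendsto_sphereWalk_coord [NeZero d] [IsProbabilityMeasure P]
    (h : IsUniformSteps P ϑ) (hV : IsOpen V) (hVb : Bornology.IsBounded V)
    (hF : (frontier V).Nonempty) (hv : v ∈ V) (hr0 : 0 < r) (hr1 : r < 1) (i : Fin d) :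
    ∀ᵐ ω ∂P, ∃ l, Tendsto (fun n => sphereWalk V ϑ r v n ω i) atTop (𝓝 l) := by
  obtain ⟨C, hC⟩ := hVb.exists_norm_le
  -- The shift by one makes `f n` measurable with respect to the steps `ϑ 0, …, ϑ n`.
  set f : ℕ → Ω → ℝ := fun n ω => sphereWalk V ϑ r v (n + 1) ω i with hf
  have hcoord : Measurable fun x : 𝔼 => x i := by fun_prop
  have hfC : ∀ n, ∀ᵐ ω ∂P, ‖f n ω‖ ≤ C := by
    intro n
    filter_upwards [h.ae_norm_eq_one] with ω hω
    exact (PiLp.norm_apply_le _ i).trans (hC _ (sphereWalk_mem hV hF hv hr0 hr1 hω (n + 1)))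
  have hadp : StronglyAdapted h.filtration f := fun n =>
    (hcoord.comp (h.measurable_sphereWalk_succ n)).stronglyMeasurable
  have hint : ∀ n, Integrable (f n) P := fun n =>
    Integrable.of_bound (hcoord.comp (h.measurable_sphereWalk (n + 1))).aestronglyMeasurable C
      (hfC n)
  have hmart : Martingale f h.filtration P := by
    refine martingale_of_condExp_sub_eq_zero_nat hadp hint fun n => ?_
    -- The increment is the product of the predictable factor `a` and the centred, independent `b`.
    set a : Ω → ℝ := fun ω =>
      r * Metric.infDist (sphereWalk V ϑ r v (n + 1) ω) (frontier V)
    set b : Ω → ℝ := fun ω => ϑ (n + 1) ω i with hb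
    have hab : f (n + 1) - f n = a * b := by
      ext ω
      simp [hf, sphereWalk, a, b]
    have ham : StronglyMeasurable[h.filtration n] a :=
      ((Metric.continuous_infDist_pt _).measurable.comp
        (h.measurable_sphereWalk_succ n) |>.const_mul r).stronglyMeasurable
    have hbint : Integrable b P := by
      refine Integrable.of_bound (C := 1)
        (hcoord.comp (h.measurable (n + 1))).aestronglyMeasurable ?_
      filter_upwards [h.ae_norm_eq_one] with ω hω
      exact (PiLp.norm_apply_le _ i).trans (hω (n + 1)).le
    have habint : Integrable (a * b) P := hab ▸ (hint (n + 1)).sub (hint n)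
    have hbm : StronglyMeasurable[MeasurableSpace.comap (ϑ (n + 1)) inferInstance] b :=
      (hcoord.comp (comap_measurable (ϑ (n + 1)))).stronglyMeasurable
    have hbc : P[b | h.filtration n] =ᵐ[P] fun _ => ∫ ω, b ω ∂P :=
      condExp_indep_eq (h.measurable (n + 1)).comap_le (h.filtration.le n) hbm
        (h.iIndepFun.indep_comap_natural_of_lt
          (fun n => (h.measurable n).stronglyMeasurable) (Nat.lt_succ_self n))
    have hb0 : ∫ ω, b ω ∂P = 0 := by
      rw [← integral_coord_uniformSphere i, ← h.map_eq (n + 1),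
        integral_map (h.measurable (n + 1)).aemeasurable hcoord.aestronglyMeasurable]
    rw [hab]
    filter_upwards [condExp_mul_of_stronglyMeasurable_left ham habint hbint, hbc] with ω h1 h2
    rw [h1, Pi.mul_apply, h2, hb0, mul_zero, Pi.zero_apply]
  have hconv := hmart.submartingale.ae_tendsto_limitProcess (R := Real.toNNReal C) fun n => by
    refine (eLpNorm_le_of_ae_bound (hfC n)).trans ?_
    simp [ENNReal.ofReal]
  filter_upwards [hconv] with ω hω
  exact ⟨_, (tendsto_add_atTop_iff_nat 1).1 hω⟩

theorem ae_tendsto_sphereWalk [NeZero d] [IsProbabilityMeasure P]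
    (h : IsUniformSteps P ϑ) (hV : IsOpen V) (hVb : Bornology.IsBounded V)
    (hF : (frontier V).Nonempty) (hv : v ∈ V) (hr0 : 0 < r) (hr1 : r < 1) :
    ∀ᵐ ω ∂P, Tendsto (fun n => sphereWalk V ϑ r v n ω) atTop (𝓝 (sphereWalkLimit V ϑ r v ω)) ∧
        sphereWalkLimit V ϑ r v ω ∈ frontier V := by
  have hall := ae_all_iff.2 fun i =>
    ae_exists_tendsto_sphereWalk_coord h hV hVb hF hv hr0 hr1 i
  filter_upwards [hall, h.ae_norm_eq_one] with ω hω hnorm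
  choose l hl using hω
  have hlim : Tendsto (fun n => sphereWalk V ϑ r v n ω) atTop (𝓝 (WithLp.toLp 2 l)) := by
    have h1 : Tendsto (fun n => (sphereWalk V ϑ r v n ω).ofLp) atTop (𝓝 l) :=
      tendsto_pi_nhds.2 hl
    exact ((PiLp.continuous_toLp 2 _).tendsto l).comp h1
  have hlim' : Tendsto (fun n => sphereWalk V ϑ r v n ω) atTop
      (𝓝 (sphereWalkLimit V ϑ r v ω)) := tendsto_nhds_limUnder ⟨_, hlim⟩
  refine ⟨hlim', ?_⟩
  set y := sphereWalkLimit V ϑ r v ω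
  -- The step lengths tend to zero, and they are proportional to the distance to the boundary.
  have hdiff : Tendsto (fun n => ‖sphereWalk V ϑ r v (n + 1) ω - sphereWalk V ϑ r v n ω‖) atTop
      (𝓝 0) := by
    have := (((tendsto_add_atTop_iff_nat 1).2 hlim').sub hlim').norm
    simpa using this
  have hdiff' : Tendsto (fun n => ‖sphereWalk V ϑ r v (n + 1) ω - sphereWalk V ϑ r v n ω‖) atTop
      (𝓝 (r * Metric.infDist y (frontier V))) := by
    have h1 : ∀ n, ‖sphereWalk V ϑ r v (n + 1) ω - sphereWalk V ϑ r v n ω‖ =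
        r * Metric.infDist (sphereWalk V ϑ r v n ω) (frontier V) := by
      intro n
      have : 0 ≤ Metric.infDist (sphereWalk V ϑ r v n ω) (frontier V) := Metric.infDist_nonneg
      simp [sphereWalk, norm_smul, hnorm, abs_of_pos hr0, abs_of_nonneg this]
    simp_rw [h1]
    exact (((Metric.continuous_infDist_pt _).tendsto y).comp hlim').const_mul r
  have hzero := tendsto_nhds_unique hdiff' hdiff
  have hy := (mul_eq_zero.1 hzero).resolve_left hr0.ne'
  exact (isClosed_frontier.mem_iff_infDist_zero hF).2 hy

theorem tendsto_integral_sphereWalk [NeZero d] [IsProbabilityMeasure P]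
    (h : IsUniformSteps P ϑ) (hV : IsOpen V) (hVb : Bornology.IsBounded V)
    (hF : (frontier V).Nonempty) (hv : v ∈ V) (hr0 : 0 < r) (hr1 : r < 1)
    {g : 𝔼 → ℝ} (hg : Continuous g) :
    Tendsto (fun n => ∫ ω, g (sphereWalk V ϑ r v n ω) ∂P) atTop
      (𝓝 (∫ ω, g (sphereWalkLimit V ϑ r v ω) ∂P)) := by
  obtain ⟨C, hC⟩ := hVb.isCompact_closure.exists_bound_of_continuousOn hg.continuousOn
  refine tendsto_integral_of_dominated_convergence (fun _ => C)
    (fun n => (hg.measurable.comp (h.measurable_sphereWalk n)).aestronglyMeasurable)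
    (integrable_const _) (fun n => ?_) ?_
  · filter_upwards [h.ae_norm_eq_one] with ω hω
    exact hC _ (subset_closure (sphereWalk_mem hV hF hv hr0 hr1 hω n))
  · filter_upwards [ae_tendsto_sphereWalk h hV hVb hF hv hr0 hr1] with ω hω
    exact (hg.tendsto _).comp hω.1

/-- Only the values of `f` on the boundary matter; a continuous extension of `f` from there provides
the measurability. -/
theorem integrable_comp_sphereWalkLimit [NeZero d] [IsProbabilityMeasure P]
    (h : IsUniformSteps P ϑ) (hV : IsOpen V) (hVb : Bornology.IsBounded V)
    (hF : (frontier V).Nonempty) (hv : v ∈ V) (hr0 : 0 < r) (hr1 : r < 1)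
    {f : 𝔼 → ℝ} (hf : ContinuousOn f (frontier V)) :
    Integrable (fun ω => f (sphereWalkLimit V ϑ r v ω)) P := by
  have hlim := ae_tendsto_sphereWalk h hV hVb hF hv hr0 hr1
  have hcomp : IsCompact (frontier V) :=
    hVb.isCompact_closure.of_isClosed_subset isClosed_frontier frontier_subset_closure
  obtain ⟨C, hC⟩ := hcomp.exists_bound_of_continuousOn hf
  have hm : AEMeasurable (sphereWalkLimit V ϑ r v) P :=
    aemeasurable_of_tendsto_metrizable_ae atTop
      (fun n => (h.measurable_sphereWalk n).aemeasurable) (hlim.mono fun ω hω => hω.1)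
  obtain ⟨F, hF'⟩ := ContinuousMap.exists_restrict_eq isClosed_frontier
    (⟨(frontier V).domRestrict f, hf.domRestrict⟩ : C(frontier V, ℝ))
  have hFf : ∀ x ∈ frontier V, F x = f x := fun x hx => DFunLike.congr_fun hF' ⟨x, hx⟩
  refine Integrable.of_bound (C := C) ?_ ?_
  · refine (F.continuous.measurable.comp_aemeasurable hm).aestronglyMeasurable.congr ?_
    filter_upwards [hlim] with ω hω
    exact hFf _ hω.2
  · filter_upwards [hlim] with ω hω
    exact hC _ hω.2

end

/-! ### Functions with the mean value property are harmonic -/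

/-- A function whose means over spheres about the origin of radius less than `R` are equal to `m`
integrates against a radial weight supported in the ball of radius `R` to `m` times the integral
of the weight. -/
theorem integral_mul_radial [NeZero d] {g φ : 𝔼 → ℝ} {R m : ℝ}
    (hφ : ∀ x y : 𝔼, ‖x‖ = ‖y‖ → φ x = φ y) (hφR : ∀ x, R ≤ ‖x‖ → φ x = 0)
    (hφi : Integrable φ) (hgφ : Integrable fun y => g y * φ y)
    (hm : ∀ ρ, 0 < ρ → ρ < R → sphereMean g 0 ρ = m) :
    ∫ y, g y * φ y = m * ∫ y, φ y := by
  obtain ⟨e, he⟩ : ∃ e : 𝔼, ‖e‖ = 1 := exists_norm_eq 𝔼 zero_le_one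
  have hρ : ∀ ρ : ℝ, ∀ θ : 𝔼, ‖θ‖ = 1 → φ (ρ • θ) = φ (ρ • e) := by
    intro ρ θ hθ
    apply hφ
    rw [norm_smul, norm_smul, hθ, he]
  rw [integral_eq_integral_polar hgφ, integral_eq_integral_polar hφi, mul_left_comm]
  congr 1
  rw [← integral_const_mul]
  refine setIntegral_congr_fun measurableSet_Ioi fun ρ hρ0 => ?_
  have h1 : ∫ θ, φ (ρ • θ) ∂uniformSphere d = φ (ρ • e) := by
    rw [integral_congr_ae (g := fun _ => φ (ρ • e))]
    · simp
    · filter_upwards [ae_norm_eq_one_uniformSphere] with θ hθ using hρ ρ θ hθ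
  have h2 : ∫ θ, g (ρ • θ) * φ (ρ • θ) ∂uniformSphere d = sphereMean g 0 ρ * φ (ρ • e) := by
    rw [sphereMean, ← integral_mul_const]
    refine integral_congr_ae ?_
    filter_upwards [ae_norm_eq_one_uniformSphere] with θ hθ
    rw [hρ ρ θ hθ, zero_add]
  simp only [h1, h2]
  by_cases hlt : ρ < R
  · rw [hm ρ hρ0 hlt]; ring
  · have : φ (ρ • e) = 0 := by
      apply hφR
      rw [norm_smul, he, mul_one, Real.norm_eq_abs, abs_of_pos hρ0]
      exact not_lt.1 hlt
    simp [this]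

/-- A smooth radial bump function, supported in the ball of radius `R` when `R > 0`. -/
noncomputable def radialBump (R : ℝ) (y : 𝔼) : ℝ := Real.smoothTransition (1 - ‖y‖ ^ 2 / R ^ 2)

theorem contDiff_radialBump {n : ℕ∞} (R : ℝ) : ContDiff ℝ n (radialBump R : 𝔼 → ℝ) :=
  Real.smoothTransition.contDiff.comp (contDiff_const.sub ((contDiff_norm_sq ℝ).div_const _))

theorem radialBump_eq_zero {R : ℝ} (hR : 0 < R) {y : 𝔼} (hy : R ≤ ‖y‖) : radialBump R y = 0 := by
  apply Real.smoothTransition.zero_of_nonpos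
  rw [sub_nonpos, one_le_div (by positivity)]
  exact pow_le_pow_left₀ hR.le hy 2

theorem hasCompactSupport_radialBump {R : ℝ} (hR : 0 < R) :
    HasCompactSupport (radialBump R : 𝔼 → ℝ) := by
  refine HasCompactSupport.intro (isCompact_closedBall 0 R) fun y hy => radialBump_eq_zero hR ?_
  have : R < ‖y‖ := by simpa using hy
  exact this.le

theorem integral_radialBump_pos {R : ℝ} (hR : 0 < R) : 0 < ∫ y : 𝔼, radialBump R y := by
  have hc : Continuous (radialBump R : 𝔼 → ℝ) := (contDiff_radialBump (n := 0) R).continuous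
  refine hc.integral_pos_of_hasCompactSupport_nonneg_nonzero (hasCompactSupport_radialBump hR)
    (fun y => Real.smoothTransition.nonneg _) (x := 0) ?_
  simp [radialBump]

/-- A bounded measurable function with the mean value property on small spheres near a point is
smooth there, because up to a constant factor it coincides with its convolution with a radial bump
function. -/
theorem contDiffAt_of_sphereMean_eq [NeZero d] {g : 𝔼 → ℝ} (hg : Measurable g) {C : ℝ}
    (hC : ∀ x, |g x| ≤ C) {x : 𝔼} {R : ℝ} (hR : 0 < R)
    (hm : ∀ y ∈ Metric.ball x R, ∀ ρ, 0 < ρ → ρ < R → sphereMean g y ρ = g y) :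
    ContDiffAt ℝ 2 g x := by
  have hc : Continuous (radialBump R : 𝔼 → ℝ) := (contDiff_radialBump (n := 0) R).continuous
  have hcs := hasCompactSupport_radialBump (d := d) hR
  have hφi : Integrable (radialBump R : 𝔼 → ℝ) := hc.integrable_of_hasCompactSupport hcs
  have hloc : LocallyIntegrable g := by
    refine LocallyIntegrable.mono (locallyIntegrable_const C) hg.aestronglyMeasurable ?_
    refine Eventually.of_forall fun y => ?_
    rw [Real.norm_eq_abs, Real.norm_eq_abs]
    exact (hC y).trans (le_abs_self C)
  have hconv : ContDiff ℝ 2 (convolution (radialBump R : 𝔼 → ℝ) g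
      (ContinuousLinearMap.mul ℝ ℝ) volume) :=
    hcs.contDiff_convolution_left (n := 2) _ (contDiff_radialBump R) hloc
  have heq : ∀ y ∈ Metric.ball x R, convolution (radialBump R : 𝔼 → ℝ) g
      (ContinuousLinearMap.mul ℝ ℝ) volume y = g y * ∫ z : 𝔼, radialBump R z := by
    intro y hy
    have hsym : ∀ z : 𝔼, radialBump R (-z) = radialBump R z := fun z => by simp [radialBump]
    have h1 : convolution (radialBump R : 𝔼 → ℝ) g (ContinuousLinearMap.mul ℝ ℝ) volume y =
        ∫ z : 𝔼, g (y + z) * radialBump R z := by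
      rw [convolution_def, ← integral_neg_eq_self]
      refine integral_congr_ae (Eventually.of_forall fun z => ?_)
      simp [hsym, mul_comm]
    rw [h1]
    refine integral_mul_radial (R := R) (fun a b hab => by simp [radialBump, hab])
      (fun a ha => radialBump_eq_zero hR ha) hφi ?_ fun ρ hρ hρR => ?_
    · refine hφi.bdd_mul (c := C) ?_ (Eventually.of_forall fun z => hC _)
      exact (hg.comp (measurable_const_add y)).aestronglyMeasurable
    · rw [← hm y hy ρ hρ hρR]
      simp [sphereMean]
  have hpos := integral_radialBump_pos (d := d) hR
  refine (hconv.contDiffAt.div_const (∫ z : 𝔼, radialBump R z)).congr_of_eventuallyEq ?_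
  filter_upwards [Metric.ball_mem_nhds x hR] with y hy
  rw [heq y hy, mul_div_cancel_right₀ _ hpos.ne']

theorem integral_bilin_uniformSphere [NeZero d] (B : 𝔼 →L[ℝ] 𝔼 →L[ℝ] ℝ) (ρ : ℝ) :
    ∫ θ, B (ρ • θ) (ρ • θ) ∂uniformSphere d =
      ρ ^ 2 * ((d : ℝ)⁻¹ * ∑ i, B (EuclideanSpace.single i 1) (EuclideanSpace.single i 1)) := by
  have hB : ∀ θ : 𝔼, B (ρ • θ) (ρ • θ) = ρ ^ 2 * ∑ i, ∑ j,
      B (EuclideanSpace.single i 1) (EuclideanSpace.single j 1) * (θ i * θ j) := by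
    intro θ
    have hθ : θ = ∑ i, θ i • EuclideanSpace.single i (1 : ℝ) := by
      have := (EuclideanSpace.basisFun (Fin d) ℝ).sum_repr θ
      simpa using this.symm
    rw [map_smul, map_smul, smul_apply, smul_smul, ← sq, smul_eq_mul]
    congr 1
    conv_lhs => rw [hθ]
    simp only [map_sum, map_smul, sum_apply, smul_apply,
      smul_eq_mul, Finset.mul_sum]
    rw [Finset.sum_comm]
    refine Finset.sum_congr rfl fun i _ => Finset.sum_congr rfl fun j _ => by ring
  have hint : ∀ i j : Fin d, Integrable (fun θ : 𝔼 => θ i * θ j) (uniformSphere d) := by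
    intro i j
    have := (by fun_prop : Continuous fun θ : 𝔼 => θ i * θ j).integrable_comp_sphere 0
      (zero_le_one (α := ℝ))
    simpa using this
  simp_rw [hB]
  rw [integral_const_mul, integral_finsetSum]
  · congr 1
    rw [Finset.mul_sum]
    refine Finset.sum_congr rfl fun i _ => ?_
    rw [integral_finsetSum _ fun j _ => (hint i j).const_mul _]
    simp_rw [integral_const_mul, integral_mul_uniformSphere]
    simp [mul_comm]
  · exact fun i _ => integrable_finsetSum _ fun j _ => (hint i j).const_mul _

/-- The second order Taylor expansion: the derivative of the remainder is `o(‖y‖)`, and the mean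
value inequality bounds the remainder itself. -/
theorem taylor_two_isLittleO {g : 𝔼 → ℝ} {x : 𝔼} (hg : ContDiffAt ℝ 2 g x) :
    (fun y : 𝔼 => g (x + y) - g x - fderiv ℝ g x y - (1 / 2) * fderiv ℝ (fderiv ℝ g) x y y)
      =o[𝓝 0] fun y => ‖y‖ ^ 2 := by
  set B := fderiv ℝ (fderiv ℝ g) x with hB
  have hsymm : ∀ a b, B a b = B b a := fun a b =>
    (hg.isSymmSndFDerivAt (by simp)).eq a b
  have hd1 : ∀ᶠ y in 𝓝 (0 : 𝔼), DifferentiableAt ℝ g (x + y) := by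
    have h1 : ∀ᶠ z in 𝓝 x, DifferentiableAt ℝ g z := by
      filter_upwards [hg.eventually (by simp)] with z hz using hz.differentiableAt (by simp)
    have h2 : Tendsto (fun y : 𝔼 => x + y) (𝓝 0) (𝓝 x) := by
      simpa using (continuous_const_add x).tendsto (0 : 𝔼)
    exact h2.eventually h1
  have hd2 : DifferentiableAt ℝ (fderiv ℝ g) x :=
    (hg.fderiv_right (m := 1) (by norm_num)).differentiableAt (by simp)
  have hlo : (fun y : 𝔼 => fderiv ℝ g (x + y) - fderiv ℝ g x - B y) =o[𝓝 0] fun y => y :=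
    hasFDerivAt_iff_isLittleO_nhds_zero.1 hd2.hasFDerivAt
  rw [Asymptotics.isLittleO_iff]
  intro c hc
  obtain ⟨δ, hδ, hball⟩ := Metric.eventually_nhds_iff_ball.1 (hd1.and (hlo.def hc))
  filter_upwards [Metric.ball_mem_nhds (0 : 𝔼) hδ] with y hy
  set e : 𝔼 → ℝ := fun y => g (x + y) - g x - fderiv ℝ g x y - (1 / 2) * B y y with he
  have hde : ∀ z ∈ Metric.ball (0 : 𝔼) δ,
      HasFDerivAt e (fderiv ℝ g (x + z) - fderiv ℝ g x - B z) z := by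
    intro z hz
    have h1 : HasFDerivAt (fun y => g (x + y)) (fderiv ℝ g (x + z)) z :=
      (hasFDerivAt_comp_add_left x).2 (hball z hz).1.hasFDerivAt
    have h2 : HasFDerivAt (fun y => B y y) (B z + B.flip z) z := by
      have := B.hasFDerivAt_of_bilinear (hasFDerivAt_id z) (hasFDerivAt_id z)
      refine this.congr_fderiv ?_
      ext w
      simp
    refine (((h1.sub_const _).sub (fderiv ℝ g x).hasFDerivAt).sub
      (h2.const_mul (1 / 2))).congr_fderiv ?_
    ext w
    simp [hsymm w z]
    ring
  have hy' : ‖y‖ < δ := by simpa using hy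
  have hmvt := (convex_closedBall (0 : 𝔼) ‖y‖).norm_image_sub_le_of_norm_hasFDerivWithin_le
    (f := e) (C := c * ‖y‖) (x := 0) (y := y)
    (fun z hz => (hde z (Metric.closedBall_subset_ball hy' hz)).hasFDerivWithinAt)
    (fun z hz => ((hball z (Metric.closedBall_subset_ball hy' hz)).2).trans
      (mul_le_mul_of_nonneg_left (by simpa using hz) hc.le)) (by simp) (by simp)
  have he0 : e 0 = 0 := by simp [he]
  rw [he0, sub_zero, sub_zero] at hmvt
  rw [norm_pow, norm_norm, sq, ← mul_assoc]
  exact hmvt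

theorem laplacian_eq_sum_fderiv (g : 𝔼 → ℝ) (x : 𝔼) :
    Laplacian.laplacian g x = ∑ i, fderiv ℝ (fderiv ℝ g) x (EuclideanSpace.single i 1)
      (EuclideanSpace.single i 1) := by
  rw [InnerProductSpace.laplacian_eq_iteratedFDeriv_orthonormalBasis g
    (EuclideanSpace.basisFun (Fin d) ℝ)]
  simp [iteratedFDeriv_two_apply]

/-- By Taylor expansion, the mean over a sphere of radius `ρ` exceeds the value at the centre by
`ρ² / (2d)` times the Laplacian, up to `o(ρ²)`; thus the mean value property forces the Laplacian
to vanish. -/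
theorem laplacian_eq_zero_of_sphereMean_eq [NeZero d] {g : 𝔼 → ℝ} (hgm : Measurable g) {C : ℝ}
    (hC : ∀ x, |g x| ≤ C) {x : 𝔼} (hg : ContDiffAt ℝ 2 g x)
    (hm : ∀ᶠ ρ in 𝓝[>] 0, sphereMean g x ρ = g x) : Laplacian.laplacian g x = 0 := by
  rw [laplacian_eq_sum_fderiv]
  set B := fderiv ℝ (fderiv ℝ g) x with hB
  set T := ∑ i, B (EuclideanSpace.single i 1) (EuclideanSpace.single i 1) with hT
  have hd : (0 : ℝ) < d := Nat.cast_pos.2 (Nat.pos_of_ne_zero (NeZero.ne d))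
  by_contra hne
  have hTpos : 0 < |T| := abs_pos.2 hne
  set c := |T| / (4 * d) with hc
  have hcpos : 0 < c := by positivity
  obtain ⟨δ, hδ, hball⟩ := Metric.eventually_nhds_iff_ball.1
    ((taylor_two_isLittleO hg).def hcpos)
  obtain ⟨ρ, hρm, hρ0, hρδ⟩ := (hm.and (Ioo_mem_nhdsGT hδ)).exists
  have hint1 : Integrable (fun θ => g (x + ρ • θ)) (uniformSphere d) :=
    integrable_comp_sphere hgm hρ0.le fun y _ => hC y
  have hint2 : Integrable (fun θ => fderiv ℝ g x (ρ • θ)) (uniformSphere d) := by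
    have := (fderiv ℝ g x).continuous.integrable_comp_sphere 0 hρ0.le
    simpa using this
  have hint3 : Integrable (fun θ => (1 / 2) * B (ρ • θ) (ρ • θ)) (uniformSphere d) := by
    have := (by fun_prop : Continuous fun y => (1 / 2) * B y y).integrable_comp_sphere 0 hρ0.le
    simpa using this
  have hint4 : Integrable (fun θ => g (x + ρ • θ) - g x) (uniformSphere d) :=
    hint1.sub (integrable_const _)
  have hint5 : Integrable (fun θ => g (x + ρ • θ) - g x - fderiv ℝ g x (ρ • θ))
      (uniformSphere d) := hint4.sub hint2
  have hlin : ∫ θ, fderiv ℝ g x (ρ • θ) ∂uniformSphere d = 0 := by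
    have := integral_inner_uniformSphere (ρ • (InnerProductSpace.toDual ℝ 𝔼).symm (fderiv ℝ g x))
    simpa [inner_smul_left] using this
  have hI : ∫ θ, (g (x + ρ • θ) - g x - fderiv ℝ g x (ρ • θ) -
      (1 / 2) * B (ρ • θ) (ρ • θ)) ∂uniformSphere d = - (ρ ^ 2 * (T / (2 * d))) := by
    rw [integral_sub hint5 hint3, integral_sub hint4 hint2, integral_sub hint1 (integrable_const _),
      hlin, integral_const_mul, integral_bilin_uniformSphere]
    have : ∫ θ, g (x + ρ • θ) ∂uniformSphere d = g x := hρm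
    rw [this]
    simp only [integral_const, probReal_univ, one_smul, ← hT]
    field_simp
    ring
  have hbound := norm_integral_le_of_norm_le_const (μ := uniformSphere d) (C := c * ρ ^ 2)
    (f := fun θ => g (x + ρ • θ) - g x - fderiv ℝ g x (ρ • θ) - (1 / 2) * B (ρ • θ) (ρ • θ)) (by
      filter_upwards [ae_norm_eq_one_uniformSphere] with θ hθ
      have hn : ‖ρ • θ‖ = ρ := by rw [norm_smul, hθ, mul_one, Real.norm_eq_abs, abs_of_pos hρ0]
      have := hball (ρ • θ) (by simpa [hn] using hρδ)
      rw [hn, norm_pow, Real.norm_eq_abs ρ, abs_of_pos hρ0] at this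
      exact this)
  rw [hI, norm_neg, norm_mul, Real.norm_eq_abs, Real.norm_eq_abs, abs_of_nonneg (sq_nonneg ρ),
    abs_div, abs_of_pos (by positivity : (0 : ℝ) < 2 * d), probReal_univ, mul_one, hc] at hbound
  have hρ2 : 0 < ρ ^ 2 := by positivity
  have h4 : |T| / (2 * d) ≤ |T| / (4 * d) := by
    rw [mul_comm] at hbound
    exact le_of_mul_le_mul_right hbound hρ2
  have h5 : |T| / (4 * d) < |T| / (2 * d) :=
    div_lt_div_of_pos_left hTpos (by positivity) (by linarith)
  linarith

/-- A bounded measurable function with the mean value property on an open set is harmonic. -/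
theorem harmonicOnNhd_of_sphereMean_eq [NeZero d] {V : Set 𝔼} (hV : IsOpen V) {g : 𝔼 → ℝ}
    (hg : Measurable g) {C : ℝ} (hC : ∀ x ∈ V, |g x| ≤ C)
    (hm : ∀ x ρ, 0 ≤ ρ → Metric.closedBall x ρ ⊆ V → sphereMean g x ρ = g x) :
    InnerProductSpace.HarmonicOnNhd g V := by
  -- Cut off outside `V` to obtain a globally bounded function, as the convolution requires.
  set g' : 𝔼 → ℝ := V.indicator g with hg'
  have hg'm : Measurable g' := hg.indicator hV.measurableSet
  have hC' : ∀ x, |g' x| ≤ |C| := by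
    intro x
    by_cases hx : x ∈ V
    · rw [hg', Set.indicator_of_mem hx]
      exact (hC x hx).trans (le_abs_self C)
    · rw [hg', Set.indicator_of_notMem hx, abs_zero]
      exact abs_nonneg C
  have hm' : ∀ x ρ, 0 ≤ ρ → Metric.closedBall x ρ ⊆ V → sphereMean g' x ρ = g' x := by
    intro x ρ hρ hx
    rw [hg', Set.indicator_of_mem (hx (Metric.mem_closedBall_self hρ)), ← hm x ρ hρ hx]
    exact sphereMean_congr hρ fun y hy =>
      Set.indicator_of_mem (hx (Metric.sphere_subset_closedBall hy)) g
  have hcd : ∀ x ∈ V, ContDiffAt ℝ 2 g' x := by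
    intro x hx
    obtain ⟨ε, hε, hεV⟩ := Metric.isOpen_iff.1 hV x hx
    refine contDiffAt_of_sphereMean_eq hg'm hC' (R := ε / 2) (by positivity) fun y hy ρ hρ hρε => ?_
    refine hm' y ρ hρ.le ((Metric.closedBall_subset_ball' ?_).trans hεV)
    rw [Metric.mem_ball] at hy
    linarith
  have hlap : ∀ x ∈ V, Laplacian.laplacian g' x = 0 := by
    intro x hx
    refine laplacian_eq_zero_of_sphereMean_eq hg'm hC' (hcd x hx) ?_
    obtain ⟨δ, hδ, hδV⟩ := Metric.nhds_basis_closedBall.mem_iff.1 (hV.mem_nhds hx)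
    filter_upwards [Ioc_mem_nhdsGT hδ] with ρ hρ
    exact hm' x ρ hρ.1.le ((Metric.closedBall_subset_closedBall hρ.2).trans hδV)
  intro x hx
  have heq : g =ᶠ[𝓝 x] g' := by
    filter_upwards [hV.mem_nhds hx] with y hy
    rw [hg', Set.indicator_of_mem hy]
  rw [InnerProductSpace.harmonicAt_congr_nhds heq]
  refine ⟨hcd x hx, ?_⟩
  filter_upwards [hV.mem_nhds hx] with y hy using hlap y hy

/-! ### Expectations at the limit of the walk -/

section

/-- The exponentials `x ↦ exp ⟪a, x⟫`. -/
noncomputable def expInner (a : 𝔼) (x : 𝔼) : ℝ := Real.exp (inner ℝ a x)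

theorem continuous_expInner (a : 𝔼) : Continuous (expInner a) := by
  unfold expInner; fun_prop

/-- Exponentials of linear functions are convex, hence subharmonic. -/
theorem expInner_le_sphereMean [NeZero d] (a x : 𝔼) {ρ : ℝ} (hρ : 0 ≤ ρ) :
    expInner a x ≤ sphereMean (expInner a) x ρ := by
  have hint : Integrable (fun θ : 𝔼 => inner ℝ a θ) (uniformSphere d) := by
    have := (by fun_prop : Continuous fun θ : 𝔼 => inner ℝ a θ).integrable_comp_sphere 0
      (zero_le_one (α := ℝ))
    simpa using this
  have hlin : ∫ θ, expInner a x * (1 + ρ * inner ℝ a θ) ∂uniformSphere d = expInner a x := by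
    rw [integral_const_mul, integral_add (integrable_const _) (hint.const_mul _),
      integral_const_mul, integral_inner_uniformSphere]
    simp
  rw [← hlin]
  refine integral_mono (((integrable_const _).add (hint.const_mul _)).const_mul _)
    ((continuous_expInner a).integrable_comp_sphere x hρ) fun θ => ?_
  simp only [expInner, inner_add_right, inner_smul_right, Real.exp_add]
  refine mul_le_mul_of_nonneg_left ?_ (Real.exp_pos _).le
  rw [add_comm]
  exact Real.add_one_le_exp _

theorem isSubharmonicAbove_expInner [NeZero d] (V : Set 𝔼) (a : 𝔼) :
    IsSubharmonicAbove V (expInner a) (expInner a) where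
  continuous := continuous_expInner a
  submean x _ := by
    filter_upwards [self_mem_nhdsWithin] with ρ hρ
    exact expInner_le_sphereMean a x (le_of_lt hρ)
  le _ := le_rfl
  eq_of_notMem _ _ := rfl

variable {V : Set (EuclideanSpace ℝ (Fin d))} {Ω : Type*} [MeasurableSpace Ω] {P : Measure Ω}
  {ϑ : ℕ → Ω → EuclideanSpace ℝ (Fin d)} {r : ℝ}

/-- On `V`, the expectation of `f` at the limit of the walk is the restriction of a measurable
function which is bounded on `V` and has the mean value property there. -/
def HasHarmonicExpectation (P : Measure Ω) (V : Set 𝔼) (ϑ : ℕ → Ω → 𝔼) (r : ℝ) (f : 𝔼 → ℝ) :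
    Prop :=
  ∃ H : 𝔼 → ℝ, Measurable H ∧ (∃ C, ∀ x ∈ V, |H x| ≤ C) ∧
    (∀ x ρ, 0 ≤ ρ → Metric.closedBall x ρ ⊆ V → sphereMean H x ρ = H x) ∧
    ∀ x ∈ V, H x = ∫ ω, f (sphereWalkLimit V ϑ r x ω) ∂P

/-- Composed with the walk, a subharmonic function is a bounded submartingale, so its value at the
starting point is at most its expectation at the limit, where it agrees with `u`. -/
theorem IsSubharmonicAbove.le_integral_sphereWalkLimit [NeZero d] [IsProbabilityMeasure P]
    (h : IsUniformSteps P ϑ) (hV : IsOpen V) (hVb : Bornology.IsBounded V)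
    (hF : (frontier V).Nonempty) (hr0 : 0 < r) (hr1 : r < 1) {u w : 𝔼 → ℝ}
    (hw : IsSubharmonicAbove V u w) {v : 𝔼} (hv : v ∈ V) :
    w v ≤ ∫ ω, u (sphereWalkLimit V ϑ r v ω) ∂P := by
  obtain ⟨C, hC⟩ := hVb.isCompact_closure.exists_bound_of_continuousOn hw.continuous.continuousOn
  have hle : w v ≤ ∫ ω, w (sphereWalkLimit V ϑ r v ω) ∂P := by
    refine ge_of_tendsto' (tendsto_integral_sphereWalk h hV hVb hF hv hr0 hr1 hw.continuous)
      fun n => le_integral_sphereWalk h hV hF hv hr0 hr1 hw.continuous.measurable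
        (fun x hx => hC x (subset_closure hx)) (fun x hx => ?_) n
    refine le_sphereMean_of_submean hw.continuous
      (mul_pos hr0 (infDist_frontier_pos hV hF hx)) fun y hy => hw.submean y ?_
    exact closedBall_mul_infDist_subset hV hF hr1 hx (Metric.ball_subset_closedBall hy)
  refine hle.trans_eq (integral_congr_ae ?_)
  filter_upwards [ae_tendsto_sphereWalk h hV hVb hF hv hr0 hr1] with ω hω
  refine hw.eq_of_notMem _ fun hmem => ?_
  have := hω.2
  rw [hV.frontier_eq] at this
  exact this.2 hmem

/-- For continuous subharmonic `u` the expectation of `u` at the limit of the walk is the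
harmonic function obtained from `u` by sweeping out. -/
theorem IsSubharmonicAbove.hasHarmonicExpectation [NeZero d] [IsProbabilityMeasure P]
    (h : IsUniformSteps P ϑ) (hV : IsOpen V) (hVb : Bornology.IsBounded V)
    (hF : (frontier V).Nonempty) (hr0 : 0 < r) (hr1 : r < 1) {u : 𝔼 → ℝ}
    (hu : IsSubharmonicAbove V u u) : HasHarmonicExpectation P V ϑ r u := by
  obtain ⟨C, hC⟩ := hVb.isCompact_closure.exists_bound_of_continuousOn hu.continuous.continuousOn
  obtain ⟨H, hHm, hHb, ⟨C', hC'⟩, hHmean⟩ := exists_balayage hV hVb hu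
    (h := fun v => ∫ ω, u (sphereWalkLimit V ϑ r v ω) ∂P) (C := C)
    (fun w hw x hx => hw.le_integral_sphereWalkLimit h hV hVb hF hr0 hr1 hx) (fun x hx => by
      have := norm_integral_le_of_norm_le_const (μ := P) (C := C)
        (f := fun ω => u (sphereWalkLimit V ϑ r x ω)) (by
          filter_upwards [ae_tendsto_sphereWalk h hV hVb hF hx hr0 hr1] with ω hω
          exact hC _ (frontier_subset_closure hω.2))
      rw [probReal_univ, mul_one] at this
      exact (le_abs_self _).trans this)
  refine ⟨H, hHm, ⟨C', hC'⟩, hHmean, fun v hv => le_antisymm (hHb v hv).2 ?_⟩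
  refine le_of_tendsto' (tendsto_integral_sphereWalk h hV hVb hF hv hr0 hr1 hu.continuous)
    fun n => ?_
  -- `H` has the mean value property, so `H v ≥ E[H (X n)]`, which is at least `E[u (X n)]`.
  have hneg : -H v ≤ ∫ ω, -H (sphereWalk V ϑ r v n ω) ∂P := by
    refine le_integral_sphereWalk (g := fun x => -H x) h hV hF hv hr0 hr1 hHm.neg (C := C')
      (fun x hx => by rw [abs_neg]; exact hC' x hx) (fun x hx => ?_) n
    rw [sphereMean, integral_neg]
    exact neg_le_neg (hHmean x _ (mul_nonneg hr0.le Metric.infDist_nonneg)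
      (closedBall_mul_infDist_subset hV hF hr1 hx)).le
  rw [integral_neg, neg_le_neg_iff] at hneg
  refine le_trans (integral_mono_ae
    (integrable_comp_sphereWalk h hV hF hv hr0 hr1 hu.continuous.measurable
      (fun x hx => hC x (subset_closure hx)) n)
    (integrable_comp_sphereWalk h hV hF hv hr0 hr1 hHm hC' n) ?_) hneg
  filter_upwards [h.ae_norm_eq_one] with ω hω
  exact (hHb _ (sphereWalk_mem hV hF hv hr0 hr1 hω n)).1

theorem hasHarmonicExpectation_of_mem_span [NeZero d] [IsProbabilityMeasure P]
    (h : IsUniformSteps P ϑ) (hV : IsOpen V) (hVb : Bornology.IsBounded V)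
    (hF : (frontier V).Nonempty) (hr0 : 0 < r) (hr1 : r < 1) {g : 𝔼 → ℝ}
    (hg : g ∈ Submodule.span ℝ (Set.range (expInner : 𝔼 → 𝔼 → ℝ))) :
    Continuous g ∧ HasHarmonicExpectation P V ϑ r g := by
  have hint : ∀ {g : 𝔼 → ℝ}, Continuous g → ∀ {x}, x ∈ V →
      Integrable (fun ω => g (sphereWalkLimit V ϑ r x ω)) P := fun hg x hx =>
    integrable_comp_sphereWalkLimit h hV hVb hF hx hr0 hr1 hg.continuousOn
  have hmi : ∀ {H : 𝔼 → ℝ}, Measurable H → (∃ C, ∀ x ∈ V, |H x| ≤ C) → ∀ {x ρ}, 0 ≤ ρ →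
      Metric.closedBall x ρ ⊆ V → Integrable (fun θ => H (x + ρ • θ)) (uniformSphere d) :=
    fun hH ⟨C, hC⟩ x ρ hρ hx => integrable_comp_sphere hH hρ fun y hy =>
      hC y (hx (Metric.sphere_subset_closedBall hy))
  induction hg using Submodule.span_induction with
  | mem g hg =>
    obtain ⟨a, rfl⟩ := hg
    exact ⟨continuous_expInner a,
      (isSubharmonicAbove_expInner V a).hasHarmonicExpectation h hV hVb hF hr0 hr1⟩
  | zero =>
    refine ⟨continuous_zero, 0, measurable_zero, ⟨0, fun x _ => by simp⟩, fun x ρ _ _ => ?_,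
      fun x _ => by simp⟩
    simp [sphereMean]
  | add g₁ g₂ _ _ h₁ h₂ =>
    obtain ⟨hc₁, H₁, hm₁, ⟨C₁, hC₁⟩, hs₁, hE₁⟩ := h₁
    obtain ⟨hc₂, H₂, hm₂, ⟨C₂, hC₂⟩, hs₂, hE₂⟩ := h₂
    refine ⟨hc₁.add hc₂, fun x => H₁ x + H₂ x, hm₁.add hm₂, ⟨C₁ + C₂, fun x hx =>
      (abs_add_le _ _).trans (add_le_add (hC₁ x hx) (hC₂ x hx))⟩, fun x ρ hρ hx => ?_,
      fun x hx => ?_⟩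
    · rw [sphereMean_add (hmi hm₁ ⟨C₁, hC₁⟩ hρ hx) (hmi hm₂ ⟨C₂, hC₂⟩ hρ hx), hs₁ x ρ hρ hx,
        hs₂ x ρ hρ hx]
    · change H₁ x + H₂ x = _
      rw [hE₁ x hx, hE₂ x hx, ← integral_add (hint hc₁ hx) (hint hc₂ hx)]
      rfl
  | smul c g _ hg =>
    obtain ⟨hc, H, hm, ⟨C, hC⟩, hs, hE⟩ := hg
    refine ⟨hc.const_smul c, fun x => c * H x, hm.const_mul c, ⟨|c| * C, fun x hx => ?_⟩,
      fun x ρ hρ hx => ?_, fun x hx => ?_⟩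
    · rw [abs_mul]
      exact mul_le_mul_of_nonneg_left (hC x hx) (abs_nonneg c)
    · rw [sphereMean_const_mul, hs x ρ hρ hx]
    · change c * H x = _
      rw [hE x hx, ← integral_const_mul]
      rfl

/-- By the Stone–Weierstrass theorem, linear combinations of exponentials are uniformly dense in
the continuous functions on a compact set. -/
theorem exists_mem_span_expInner_near {K : Set 𝔼} (hK : IsCompact K) {f : 𝔼 → ℝ}
    (hf : ContinuousOn f K) {ε : ℝ} (hε : 0 < ε) :
    ∃ g ∈ Submodule.span ℝ (Set.range (expInner : 𝔼 → 𝔼 → ℝ)), ∀ x ∈ K, |g x - f x| < ε := by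
  have : CompactSpace K := isCompact_iff_compactSpace.1 hK
  let e : Multiplicative 𝔼 →* C(K, ℝ) :=
    { toFun := fun a => ⟨fun x => expInner a.toAdd (x : 𝔼), by
        have := continuous_expInner (d := d) a.toAdd
        fun_prop⟩
      map_one' := by ext x; simp [expInner]
      map_mul' := by intro a b; ext x; simp [expInner, inner_add_left, Real.exp_add] }
  let A : Subalgebra ℝ C(K, ℝ) := Algebra.adjoin ℝ (MonoidHom.mrange e : Set C(K, ℝ))
  have hA : ∀ F ∈ A, ∃ g ∈ Submodule.span ℝ (Set.range (expInner : 𝔼 → 𝔼 → ℝ)),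
      ∀ x : K, F x = g x := by
    intro F hF
    have hF' : F ∈ Submodule.span ℝ (MonoidHom.mrange e : Set C(K, ℝ)) := by
      have h1 := Algebra.adjoin_eq_span ℝ (MonoidHom.mrange e : Set C(K, ℝ))
      rw [Submonoid.closure_eq] at h1
      rw [← h1]
      exact hF
    clear hF
    induction hF' using Submodule.span_induction with
    | mem F hF =>
      obtain ⟨a, rfl⟩ := hF
      exact ⟨expInner a.toAdd, Submodule.subset_span ⟨_, rfl⟩, fun x => rfl⟩
    | zero => exact ⟨0, Submodule.zero_mem _, fun x => rfl⟩
    | add F₁ F₂ _ _ h₁ h₂ =>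
      obtain ⟨g₁, hg₁, hF₁⟩ := h₁
      obtain ⟨g₂, hg₂, hF₂⟩ := h₂
      exact ⟨g₁ + g₂, Submodule.add_mem _ hg₁ hg₂, fun x => by simp [hF₁, hF₂]⟩
    | smul c F _ h =>
      obtain ⟨g, hg, hFg⟩ := h
      exact ⟨c • g, Submodule.smul_mem _ c hg, fun x => by simp [hFg]⟩
  have hsep : A.SeparatesPoints := by
    intro x y hxy
    refine ⟨_, ⟨e (Multiplicative.ofAdd ((x : 𝔼) - y)), Algebra.subset_adjoin ⟨_, rfl⟩, rfl⟩, ?_⟩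
    intro heq
    have h1 : inner ℝ ((x : 𝔼) - y) (x : 𝔼) = inner ℝ ((x : 𝔼) - y) (y : 𝔼) :=
      Real.exp_injective heq
    rw [← sub_eq_zero, ← inner_sub_right, inner_self_eq_zero, sub_eq_zero] at h1
    exact hxy (Subtype.ext h1)
  have htop := ContinuousMap.subalgebra_topologicalClosure_eq_top_of_separatesPoints A hsep
  have hmem : (⟨K.domRestrict f, hf.domRestrict⟩ : C(K, ℝ)) ∈ A.topologicalClosure := by
    rw [htop]; trivial
  obtain ⟨F, hF, hFd⟩ := Metric.mem_closure_iff.1 hmem ε hε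
  obtain ⟨g, hg, hgF⟩ := hA F hF
  refine ⟨g, hg, fun x hx => ?_⟩
  have := (ContinuousMap.dist_apply_le_dist (⟨x, hx⟩ : K)).trans_lt hFd
  rw [dist_comm, Real.dist_eq, hgF] at this
  exact this

/-- Approximate `f` on the boundary by linear combinations of exponentials; measurability and the
mean value property pass to the uniform limit. -/
theorem hasHarmonicExpectation_of_continuousOn [NeZero d] [IsProbabilityMeasure P]
    (h : IsUniformSteps P ϑ) (hV : IsOpen V) (hVb : Bornology.IsBounded V)
    (hF : (frontier V).Nonempty) (hr0 : 0 < r) (hr1 : r < 1) {f : 𝔼 → ℝ}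
    (hf : ContinuousOn f (frontier V)) : HasHarmonicExpectation P V ϑ r f := by
  have hcomp : IsCompact (frontier V) :=
    hVb.isCompact_closure.of_isClosed_subset isClosed_frontier frontier_subset_closure
  obtain ⟨C, hC⟩ := hcomp.exists_bound_of_continuousOn hf
  have hex : ∀ n : ℕ, ∃ g ∈ Submodule.span ℝ (Set.range (expInner : 𝔼 → 𝔼 → ℝ)),
      ∀ x ∈ frontier V, |g x - f x| < 1 / ((n : ℝ) + 1) := fun n =>
    exists_mem_span_expInner_near hcomp hf Nat.one_div_pos_of_nat
  choose g hg hgf using hex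
  have hrep := fun n => hasHarmonicExpectation_of_mem_span h hV hVb hF hr0 hr1 (hg n)
  have hgc := fun n => (hrep n).1
  choose H hHm hHb hHs hHE using fun n => (hrep n).2
  set G : 𝔼 → ℝ := fun x => ∫ ω, f (sphereWalkLimit V ϑ r x ω) ∂P with hG
  have hnear : ∀ n, ∀ x ∈ V, |H n x - G x| ≤ 1 / ((n : ℝ) + 1) := by
    intro n x hx
    rw [hHE n x hx, hG, ← integral_sub
      (integrable_comp_sphereWalkLimit h hV hVb hF hx hr0 hr1 (hgc n).continuousOn)
      (integrable_comp_sphereWalkLimit h hV hVb hF hx hr0 hr1 hf)]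
    have := norm_integral_le_of_norm_le_const (μ := P) (C := 1 / ((n : ℝ) + 1))
      (f := fun ω => g n (sphereWalkLimit V ϑ r x ω) - f (sphereWalkLimit V ϑ r x ω)) (by
        filter_upwards [ae_tendsto_sphereWalk h hV hVb hF hx hr0 hr1] with ω hω
        exact (hgf n _ hω.2).le)
    simpa using this
  have hlim0 : Tendsto (fun n : ℕ => 1 / ((n : ℝ) + 1)) atTop (𝓝 0) :=
    tendsto_one_div_add_atTop_nhds_zero_nat
  have hlim : ∀ x ∈ V, Tendsto (fun n => H n x) atTop (𝓝 (G x)) := by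
    intro x hx
    rw [tendsto_iff_dist_tendsto_zero]
    exact squeeze_zero (fun _ => dist_nonneg) (fun n => hnear n x hx) hlim0
  have hGb : ∀ x ∈ V, |G x| ≤ C := by
    intro x hx
    have := norm_integral_le_of_norm_le_const (μ := P) (C := C)
      (f := fun ω => f (sphereWalkLimit V ϑ r x ω)) (by
        filter_upwards [ae_tendsto_sphereWalk h hV hVb hF hx hr0 hr1] with ω hω
        exact hC _ hω.2)
    simpa using this
  have hGm : Measurable (V.indicator G) := by
    refine measurable_of_tendsto_metrizable (f := fun n => V.indicator (H n))
      (fun n => (hHm n).indicator hV.measurableSet) (tendsto_pi_nhds.2 fun x => ?_)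
    by_cases hx : x ∈ V
    · simpa [Set.indicator_of_mem hx] using hlim x hx
    · simp [Set.indicator_of_notMem hx]
  have hind : ∀ x ∈ V, V.indicator G x = G x := fun x hx => Set.indicator_of_mem hx G
  refine ⟨V.indicator G, hGm, ⟨C, fun x hx => by rw [hind x hx]; exact hGb x hx⟩,
    fun x ρ hρ hx => ?_, hind⟩
  have hxV : x ∈ V := hx (Metric.mem_closedBall_self hρ)
  have hsV : Metric.sphere x ρ ⊆ V := Metric.sphere_subset_closedBall.trans hx
  rw [hind x hxV]
  refine tendsto_nhds_unique (f := fun n => H n x) (l := atTop) ?_ (hlim x hxV)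
  rw [tendsto_iff_dist_tendsto_zero]
  refine squeeze_zero (fun _ => dist_nonneg) (fun n => ?_) hlim0
  rw [Real.dist_eq, ← hHs n x ρ hρ hx]
  obtain ⟨B, hB⟩ := hHb n
  refine abs_sphereMean_sub_le hρ
    (integrable_comp_sphere (hHm n) hρ fun y hy => hB y (hsV hy))
    (integrable_comp_sphere hGm hρ (C := C) fun y hy => ?_) fun y hy => ?_
  · rw [hind y (hsV hy)]; exact hGb y (hsV hy)
  · rw [hind y (hsV hy)]; exact hnear n y (hsV hy)

end

end

theorem mainTheorem4 {d : ℕ} (hd : 1 ≤ d)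
    (V : Set (EuclideanSpace ℝ (Fin d))) (hVne : V.Nonempty) (hVo : IsOpen V)
    (hVb : Bornology.IsBounded V)
    (f : EuclideanSpace ℝ (Fin d) → ℝ) (hf : ContinuousOn f (frontier V))
    {Ω : Type*} [MeasurableSpace Ω] (P : Measure Ω) [IsProbabilityMeasure P]
    (ϑ : ℕ → Ω → EuclideanSpace ℝ (Fin d)) (hϑm : ∀ n, Measurable (ϑ n))
    (hϑi : iIndepFun ϑ P) (hϑu : ∀ n, P.map (ϑ n) = uniformSphere d)
    (r : ℝ) (hr0 : 0 < r) (hr1 : r < 1) :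
    (∀ v ∈ V,
      (∀ᵐ ω ∂P, Tendsto (fun n => sphereWalk V ϑ r v n ω) atTop (𝓝 (sphereWalkLimit V ϑ r v ω)) ∧
        sphereWalkLimit V ϑ r v ω ∈ frontier V) ∧
      Integrable (fun ω => f (sphereWalkLimit V ϑ r v ω)) P) ∧
    InnerProductSpace.HarmonicOnNhd (dirichletFun P V f ϑ r) V := by
  have : NeZero d := ⟨by omega⟩
  have h : IsUniformSteps P ϑ := ⟨hϑm, hϑi, hϑu⟩
  have hF := nonempty_frontier_of_isBounded hVne hVb
  refine ⟨fun v hv => ⟨ae_tendsto_sphereWalk h hVo hVb hF hv hr0 hr1,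
    integrable_comp_sphereWalkLimit h hVo hVb hF hv hr0 hr1 hf⟩, ?_⟩
  obtain ⟨H, hHm, ⟨C, hC⟩, hHs, hHE⟩ :=
    hasHarmonicExpectation_of_continuousOn h hVo hVb hF hr0 hr1 hf
  intro x hx
  have heq : dirichletFun P V f ϑ r =ᶠ[𝓝 x] H := by
    filter_upwards [hVo.mem_nhds hx] with y hy
    have hyF : y ∉ frontier V := by
      rw [hVo.frontier_eq]
      exact fun hmem => hmem.2 hy
    rw [dirichletFun, if_neg hyF, hHE y hy]
  exact (InnerProductSpace.harmonicAt_congr_nhds heq).2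
    (harmonicOnNhd_of_sphereMean_eq hVo hHm hC hHs x hx)
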